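/- **Notation.** For $n\ge 1$ let $T_n$ be the set of $321$-avoiding permutations of $\{1,\dots,n\}$, let $\mathsf{lis}(\pi)$ be the length of a longest increasing subsequence of $\pi$, and let $\mathsf{ldes}(\pi)$ be the largest $i$ with $\pi_i>\pi_{i+1}$ ($\mathsf{ldes}(\mathrm{id})=0$). Let $$b(n,k)=\frac{2k-n+1}{n+1}\binom{n+1}{k+1}.$$ For $\pi\in T_n$ let $(P,Q)$ be its pair of RSK tableaux ($P$ the insertion tableau, $Q$ the recording tableau), and let $p=p_1\cdots p_n$ and $q=q_1\cdots q_n$ be the $\pm1$ sequences of $P$ and $Q$: the $i$th term is $1$ if $i$ lies in the first row and $-1$ otherwise. These are ballot sequences, i.e. $\pm1$ sequences all of whose partial sums are nonnegative. For a ballot sequence $c=c_1\cdots c_n$ let $\varepsilon(c)$ be the smallest even $i$, $1\le i<n$, with $c_i=-c_{i+1}$ ($0$ if there is none), and let $\delta(c)$ be the greatest $i$, $1\le i<n$, with $c_i=1$, $c_{i+1}=-1$ ($0$ if there is none). Among the ballot sequences $c$ of length $n$ with exactly $k$ terms equal to $1$, let - $A_{n,k}$ consist of those with $\varepsilon(c)>0$,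 and $A^*_{n,k}$ of those with $\varepsilon(c)=0$; - $B_{n,k}$ consist of those with $0<\varepsilon(c)<\delta(c)-1$; - $B^{**}_{n,k}$ consist of those with $0<\varepsilon(c)=\delta(c)-1$ and $c_n=1$. For $c\in A_{n,k}$ let $\phi(c)$ be obtained from $c$ by exchanging the terms in positions $\varepsilon(c)$ and $\varepsilon(c)+1$. For $d=\mathsf{ldes}(\pi)$ odd and $q\in A^*_{n,k}\cup B^{**}_{n,k}$, let $\psi(q)$ be obtained from $q$ by exchanging $q_{d-1}$ and $q_j$, where $j$ is the last position of a $-1$ if $q\in A^*_{n,k}$, and the first position $j>d$ with $q_j=1$ if $q\in B^{**}_{n,k}$. For $\pi\in T_n$ with $\mathsf{lis}(\pi)=k$ and $\mathsf{ldes}(\pi)=d$, let $\Psi(\pi)$ be the permutation $\sigma\in T_n$ whose RSK tableaux have the sequences $$(p',q')=\begin{cases}(\phi(p),q)&\text{if }p\in A_{n,k},\\ (p,\phi(q))&\text{if }p\in A^*_{n,k},\ q\in B_{n,k},\\ (p,\psi(q))&\text{if }p\in A^*_{n,k},\ q\in A^*_{n,k}\cup B^{**}_{n,k},\ n-k\text{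 even},\ d\text{ odd},\\ (p,q)&\text{otherwise.}\end{cases}$$ **Proposition 4.3.** Let $n\ge 2$. For every $\pi\in T_n$ there is exactly one such $\sigma$, so $\Psi:T_n\to T_n$ is well defined. Let $f(n,d)$ be the number of $\pi\in T_n$ with $\Psi(\pi)=\pi$ and $\mathsf{ldes}(\pi)=d$. Then for all $0\le d\le n-1$: - if $n$ is odd, then $f(n,d)=b\!\left(\frac{n+d-3}{2},\frac{n-3}{2}\right)$ if $d$ is even, and $f(n,d)=0$ if $d$ is odd; - if $n$ is even, then $f(n,d)=b\!\left(\left\lfloor\frac{n+d-2}{2}\right\rfloor,\frac{n-2}{2}\right)$. -/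

import Mathlib

namespace SignBalance

/-! Permutations of `{1, …, n}` are elements of `Equiv.Perm (Fin n)`; the element `i : Fin n`
stands for the integer `i + 1`. All positions and letters below are the usual 1-based ones. -/

/-- `π` has no decreasing subsequence of length three. -/
def Avoids321 {n : ℕ} (π : Equiv.Perm (Fin n)) : Prop :=
  ¬ ∃ i j k : Fin n, i < j ∧ j < k ∧ π k < π j ∧ π j < π i

/-- The set `T_n` of 321-avoiding permutations of length `n`. -/
def T (n : ℕ) : Type := {π : Equiv.Perm (Fin n) // Avoids321 π}

/-- The identity avoids 321. -/
theorem avoids321_one (n : ℕ) : Avoids321 (1 : Equiv.Perm (Fin n)) := by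
  rintro ⟨i, j, k, hij, _, _, hji⟩
  exact lt_asymm hij hji

instance (n : ℕ) : Nonempty (T n) := ⟨⟨1, avoids321_one n⟩⟩

/-- The length of a longest increasing subsequence. -/
def lis {n : ℕ} (π : Equiv.Perm (Fin n)) : ℕ :=
  ((Finset.univ : Finset (Finset (Fin n))).filter
    (fun s => ∀ i ∈ s, ∀ j ∈ s, i < j → π i < π j)).sup Finset.card

/-- The last (largest) descent, i.e. the largest `i` with `π_i > π_{i+1}` (1-based);
it is `0` if there is no descent. -/
def ldes {n : ℕ} (π : Equiv.Perm (Fin n)) : ℕ :=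
  ((Finset.univ : Finset (Fin n)).filter
    (fun i => ∃ h : i.val + 1 < n, π ⟨i.val + 1, h⟩ < π i)).sup (fun i => i.val + 1)

/-! ### The Robinson-Schensted-Knuth correspondence

A tableau is the list of its rows, from top to bottom. -/

/-- Row insertion of `x`: `x` replaces the first entry larger than `x`, and that entry is
bumped out; if there is none, `x` is appended to the row and nothing is bumped. -/
def rowInsert (x : ℕ) : List ℕ → List ℕ × Option ℕ
  | [] => ([x], none)
  | y :: r =>
    if x < y then (x :: r, some y)
    else (y :: (rowInsert x r).1, (rowInsert x r).2)

/-- Insertion of `x` into a tableau: a bumped entry is inserted into the next row. The second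
component is the (0-based) index of the row that has become longer. -/
def tabInsert : List (List ℕ) → ℕ → List (List ℕ) × ℕ
  | [], x => ([[x]], 0)
  | r :: t, x =>
    match rowInsert x r with
    | (r', none) => (r' :: t, 0)
    | (r', some y) => (r' :: (tabInsert t y).1, (tabInsert t y).2 + 1)

/-- Put the entry `i` at the end of the row with (0-based) index `m`. -/
def addCell : List (List ℕ) → ℕ → ℕ → List (List ℕ)
  | [], _, i => [[i]]
  | r :: t, 0, i => (r ++ [i]) :: t
  | r :: t, m + 1, i => r :: addCell t m i

/-- One step of the algorithm: insert the letter `a.1`, which is at position `a.2`. -/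
def rskStep (s : List (List ℕ) × List (List ℕ)) (a : ℕ × ℕ) :
    List (List ℕ) × List (List ℕ) :=
  ((tabInsert s.1 a.1).1, addCell s.2 (tabInsert s.1 a.1).2 a.2)

/-- The pair (insertion tableau `P`, recording tableau `Q`) of the word `w`. -/
def rsk (w : List ℕ) : List (List ℕ) × List (List ℕ) :=
  (w.zipIdx 1).foldl rskStep ([], [])

/-- The word `π_1 π_2 ⋯ π_n`, with letters in `{1, …, n}`. -/
def word {n : ℕ} (π : Equiv.Perm (Fin n)) : List ℕ :=
  List.ofFn (fun i => (π i).val + 1)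

/-! ### Ballot sequences

A sequence `b_1 b_2 ⋯ b_n` is a function `b : ℕ → ℤ` that vanishes outside `{1, …, n}`. -/

/-- `b` is a ballot sequence of length `n`: all terms are `±1` and all partial sums
are nonnegative. -/
def IsBallot (n : ℕ) (b : ℕ → ℤ) : Prop :=
  (∀ i ∈ Finset.Icc 1 n, b i = 1 ∨ b i = -1) ∧ (∀ i ∉ Finset.Icc 1 n, b i = 0) ∧
    ∀ j ≤ n, 0 ≤ ∑ i ∈ Finset.Icc 1 j, b i

/-- The number of terms equal to `1`. -/
def numOnes (n : ℕ) (b : ℕ → ℤ) : ℕ := ((Finset.Icc 1 n).filter (fun i => b i = 1)).card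

/-- The sequence of a tableau with entries `1, …, n` and at most two rows: `b_i = 1` if `i` is
in the first row and `b_i = -1` otherwise. -/
def tabSeq (n : ℕ) (t : List (List ℕ)) (i : ℕ) : ℤ :=
  if i ∈ Finset.Icc 1 n then (if i ∈ t.headD [] then 1 else -1) else 0

/-- The sequence `p` given by the insertion tableau of `π`. -/
def pSeq {n : ℕ} (π : T n) : ℕ → ℤ := tabSeq n (rsk (word π.1)).1

/-- The sequence `q` given by the recording tableau of `π`. -/
def qSeq {n : ℕ} (π : T n) : ℕ → ℤ := tabSeq n (rsk (word π.1)).2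

/-- The least element of `s`, or `0` if `s` is empty. -/
def leastOrZero (s : Finset ℕ) : ℕ := if h : s.Nonempty then s.min' h else 0

/-- The largest element of `s`, or `0` if `s` is empty. -/
def greatestOrZero (s : Finset ℕ) : ℕ := s.sup id

/-- `ε(b)`: the smallest even `i`, `1 ≤ i < n`, with `b_i = -b_{i+1}`, or `0`. -/
def eps (n : ℕ) (b : ℕ → ℤ) : ℕ :=
  leastOrZero ((Finset.Ico 1 n).filter (fun i => Even i ∧ b i = - b (i + 1)))

/-- `δ(b)`: the greatest `i`, `1 ≤ i < n`, with `b_i = -b_{i+1} = 1`, or `0`. -/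
def del (n : ℕ) (b : ℕ → ℤ) : ℕ :=
  greatestOrZero ((Finset.Ico 1 n).filter (fun i => b i = 1 ∧ b (i + 1) = -1))

/-- `A_{n,k}`: ballot sequences of length `n` with `k` ones and `ε > 0`. -/
def A (n k : ℕ) : Set (ℕ → ℤ) := {b | IsBallot n b ∧ numOnes n b = k ∧ 0 < eps n b}

/-- `A*_{n,k}`: ballot sequences of length `n` with `k` ones and `ε = 0`. -/
def Astar (n k : ℕ) : Set (ℕ → ℤ) := {b | IsBallot n b ∧ numOnes n b = k ∧ eps n b = 0}

/-- `B_{n,k}`: those `b` in `A_{n,k}` with `0 < ε(b) < δ(b) - 1`. -/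
def B (n k : ℕ) : Set (ℕ → ℤ) := {b | b ∈ A n k ∧ eps n b + 1 < del n b}

/-- `B*_{n,k}`: those `b` in `A_{n,k}` with `ε(b) = δ(b) - 1`. -/
def Bstar (n k : ℕ) : Set (ℕ → ℤ) := {b | b ∈ A n k ∧ eps n b + 1 = del n b}

/-- `B**_{n,k}`: those `b` in `B*_{n,k}` with `b_n = 1`. -/
def Bstarstar (n k : ℕ) : Set (ℕ → ℤ) := {b | b ∈ Bstar n k ∧ b n = 1}

/-- Exchange the terms `b_i` and `b_j`. -/
def exchange (b : ℕ → ℤ) (i j : ℕ) : ℕ → ℤ := fun m => b (Equiv.swap i j m)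

/-- The map `φ`: exchange `b_j` and `b_{j+1}` where `j = ε(b)` (used for `ε(b) > 0`). -/
def phi (n : ℕ) (b : ℕ → ℤ) : ℕ → ℤ := exchange b (eps n b) (eps n b + 1)

/-- The map `ψ` for sequences `q` with last descent `d`. If `ε(q) = 0` then `q_{d-1}` is
exchanged with the last term `-1` of `q`; if `ε(q) > 0` then (inversely) `q_{d-1}` is
exchanged with the first term `1` to the right of `q_d`. -/
def psi (n d : ℕ) (q : ℕ → ℤ) : ℕ → ℤ :=
  if eps n q = 0 then
    exchange q (d - 1) (greatestOrZero ((Finset.Icc 1 n).filter (fun i => q i = -1)))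
  else
    exchange q (d - 1) (leastOrZero ((Finset.Icc 1 n).filter (fun i => d < i ∧ q i = 1)))

open Classical in
/-- The pair `(p', q')` of sequences which defines `Ψ(π)`. Here `k = lis π ≤ n`. -/
noncomputable def psiPair {n : ℕ} (π : T n) : (ℕ → ℤ) × (ℕ → ℤ) :=
  if pSeq π ∈ A n (lis π.1) then (phi n (pSeq π), qSeq π)
  else if pSeq π ∈ Astar n (lis π.1) ∧ qSeq π ∈ B n (lis π.1) then (pSeq π, phi n (qSeq π))
  else if pSeq π ∈ Astar n (lis π.1) ∧
      qSeq π ∈ Astar n (lis π.1) ∪ Bstarstar n (lis π.1) ∧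
      Even (n - lis π.1) ∧ Odd (ldes π.1) then (pSeq π, psi n (ldes π.1) (qSeq π))
  else (pSeq π, qSeq π)

/-- `σ` is the 321-avoiding permutation whose tableaux are given by the pair `(p', q')`
attached to `π`. -/
def IsPsi {n : ℕ} (π σ : T n) : Prop := (pSeq σ, qSeq σ) = psiPair π

/-- The map `Ψ` on `T_n`: `Ψ(π)` is the `σ` with `IsPsi π σ` (there is exactly one; this is
part of what the theorem asserts). -/
noncomputable def Psi {n : ℕ} (π : T n) : T n := Classical.epsilon (fun σ => IsPsi π σ)

/-- `f(n,d)`: the number of `π` in `T_n` with `Ψ(π) = π` and last descent `d`. -/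
noncomputable def f (n d : ℕ) : ℕ := Nat.card {π : T n // Psi π = π ∧ ldes π.1 = d}

/-- The ballot number `b(n,k) = (2k-n+1)/(n+1) * binom(n+1, k+1)`. -/
def ballotNumber (n k : ℕ) : ℚ :=
  (2 * (k : ℚ) - (n : ℚ) + 1) / ((n : ℚ) + 1) * ((n + 1).choose (k + 1) : ℚ)

end SignBalance

namespace SignBalance

/-! ### The correspondence for tableaux with at most two rows -/

/-! By RSK, a 321-avoiding permutation is the same as a pair of ballot sequences `(p, q)` with
equally many ones. The number of ones is `lis π`, and the last descent of `π` is `δ(q)`. The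
bijectivity is `exists_pSeq_qSeq_eq` with `eq_of_pSeq_eq_of_qSeq_eq`; the statistics are
`numOnes_pSeq`, `numOnes_qSeq` and `ldes_eq_del`. Well-definedness of `Ψ` then reduces to the fact
that `φ` and `ψ` preserve ballot sequences and the number of ones. This is a parity argument: where
a swap lowers partial sums by 2, these sums are at least 2.

Each nontrivial branch of `Ψ` swaps two unequal terms, so the fixed points are exactly the pairs in
the last branch. For given `k` the conditions on `p` and `q` are independent, so `f n d` is the sum
over `k` of `|A*_{n,k}|` times the number of admissible `q` with `δ(q) = d` (`f_eq_sum`).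

Having `ε = 0` means that the terms at positions `2i` and `2i + 1` agree. Since the first term is 1,
halving such a sequence of length `2m + 1` gives a ballot sequence of length `m`, so `|A*_{n,k}|` is
a ballot number `ballotNum m r` (`pairCount_odd`). An admissible `q` is determined by its first `d`
terms, because after the last descent it consists of a block of `-1` followed by a block of `1`
whose lengths are fixed by `k` (`ncard_tail`). The first `d` terms are again paired, except possibly
at the end, so these sequences are counted by sums of ballot numbers over an interval. Such sums
telescope to a difference of two binomial coefficients.

It remains to sum products of a ballot number with such a difference. The antisymmetry of `C(m,r) -
C(m,r+1)` under `r ↦ m - 1 - r` turns this half-range sum into a full Vandermonde convolution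
(`sum_ballotNum_mul`). The result is `C(N,t) - C(N,t+1)`, which is the required `b(N,t)`
(`ballotNumber_eq`). For `n` and `d` both odd, parity leaves no admissible pair. -/

/-- The tableau with first row `r₁` and second row `r₂`. -/
def twoRows : List ℕ → List ℕ → List (List ℕ)
  | [], _ => []
  | r₁, [] => [r₁]
  | r₁, r₂ => [r₁, r₂]

theorem headD_twoRows (r₁ r₂ : List ℕ) : (twoRows r₁ r₂).headD [] = r₁ := by
  cases r₁ <;> cases r₂ <;> simp [twoRows]

/-- `Run w r₁ r₂ s₁ s₂`: the word `w` can be inserted without ever using a third row, with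
rows `r₁`, `r₂` of the insertion tableau and `s₁`, `s₂` of the recording tableau. -/
inductive Run : List ℕ → List ℕ → List ℕ → List ℕ → List ℕ → Prop
  | nil : Run [] [] [] [] []
  | app {w r₁ r₂ s₁ s₂ : List ℕ} (x : ℕ) : Run w r₁ r₂ s₁ s₂ → (∀ z ∈ r₁, z < x) →
      Run (w ++ [x]) (r₁ ++ [x]) r₂ (s₁ ++ [w.length + 1]) s₂
  | bump {w l₁ l₂ r₂ s₁ s₂ : List ℕ} (x y : ℕ) : Run w (l₁ ++ y :: l₂) r₂ s₁ s₂ →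
      (∀ z ∈ l₁, z < x) → x < y → (∀ z ∈ r₂, z < y) →
      Run (w ++ [x]) (l₁ ++ x :: l₂) (r₂ ++ [y]) s₁ (s₂ ++ [w.length + 1])

theorem rowInsert_append {x : ℕ} : ∀ {r : List ℕ}, (∀ z ∈ r, z ≤ x) →
    rowInsert x r = (r ++ [x], none)
  | [], _ => rfl
  | y :: r, h => by
    have h1 : ¬ x < y := not_lt.2 (h y (by simp))
    have h2 := rowInsert_append (x := x) (r := r) (fun z hz => h z (by simp [hz]))
    simp [rowInsert, h1, h2]

theorem rowInsert_bump {x y : ℕ} {l₂ : List ℕ} (hxy : x < y) : ∀ {l₁ : List ℕ},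
    (∀ z ∈ l₁, z ≤ x) → rowInsert x (l₁ ++ y :: l₂) = (l₁ ++ x :: l₂, some y)
  | [], _ => by simp [rowInsert, hxy]
  | a :: l, h => by
    have h1 : ¬ x < a := not_lt.2 (h a (by simp))
    have h2 := rowInsert_bump hxy (l₂ := l₂) (l₁ := l) (fun z hz => h z (by simp [hz]))
    simp [rowInsert, h1, h2]

theorem exists_first_gt (x : ℕ) : ∀ r : List ℕ, (∀ z ∈ r, z ≤ x) ∨
    ∃ l₁ y l₂, r = l₁ ++ y :: l₂ ∧ (∀ z ∈ l₁, z ≤ x) ∧ x < y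
  | [] => by simp
  | a :: r => by
    by_cases h : x < a
    · exact Or.inr ⟨[], a, r, by simp, by simp, h⟩
    · rcases exists_first_gt x r with h1 | ⟨l₁, y, l₂, rfl, h1, h2⟩
      · left; simpa [not_lt.1 h] using h1
      · exact Or.inr ⟨a :: l₁, y, l₂, by simp, by simpa [not_lt.1 h] using h1, h2⟩

theorem rsk_append_singleton (w : List ℕ) (x : ℕ) :
    rsk (w ++ [x]) = rskStep (rsk w) (x, w.length + 1) := by
  simp [rsk, List.zipIdx_append, add_comm]

theorem countP_le_eq_length {r : List ℕ} {m : ℕ} (h : ∀ z ∈ r, z ≤ m) :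
    r.countP (· ≤ m) = r.length := by
  rw [List.countP_eq_length]; simpa using h

theorem countP_le_eq_zero {r : List ℕ} {m : ℕ} (h : ∀ z ∈ r, m < z) :
    r.countP (· ≤ m) = 0 := by
  rw [List.countP_eq_zero]; simpa using h

/-- Every initial segment of the integers contains at least as many entries of `r₁` as of `r₂`. -/
def Dominates (r₁ r₂ : List ℕ) : Prop :=
  ∀ m, r₂.countP (· ≤ m) ≤ r₁.countP (· ≤ m)

theorem Dominates.length_le {r₁ r₂ : List ℕ} (h : Dominates r₁ r₂) : r₂.length ≤ r₁.length := by
  have h1 : ∀ z ∈ r₂, z ≤ r₂.sum := fun z hz => List.le_sum_of_mem hz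
  have := h r₂.sum
  rw [countP_le_eq_length h1] at this
  exact this.trans List.countP_le_length

theorem pairwise_append_singleton {r : List ℕ} {x : ℕ} (h : r.Pairwise (· < ·))
    (hx : ∀ z ∈ r, z < x) : (r ++ [x]).Pairwise (· < ·) := by
  rw [List.pairwise_append]; simp [h]; exact hx

/-- The rows of a pair of tableaux of the same shape, the second one standard. -/
structure IsPair (n : ℕ) (r₁ r₂ s₁ s₂ : List ℕ) : Prop where
  len : r₁.length + r₂.length = n
  len₁ : s₁.length = r₁.length
  len₂ : s₂.length = r₂.length
  sr₁ : r₁.Pairwise (· < ·)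
  sr₂ : r₂.Pairwise (· < ·)
  ss₁ : s₁.Pairwise (· < ·)
  ss₂ : s₂.Pairwise (· < ·)
  perm : (s₁ ++ s₂).Perm (List.range' 1 n)
  dr : Dominates r₁ r₂
  ds : Dominates s₁ s₂

theorem IsPair.mem_iff {n : ℕ} {r₁ r₂ s₁ s₂ : List ℕ} (h : IsPair n r₁ r₂ s₁ s₂) (i : ℕ) :
    (i ∈ s₁ ∨ i ∈ s₂) ↔ 1 ≤ i ∧ i ≤ n := by
  rw [← List.mem_append, h.perm.mem_iff, List.mem_range'_1]; omega

theorem perm_range'_succ {s₁ s₂ : List ℕ} {n : ℕ} (h : (s₁ ++ s₂).Perm (List.range' 1 n)) :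
    ((s₁ ++ [n + 1]) ++ s₂).Perm (List.range' 1 (n + 1)) ∧
    (s₁ ++ (s₂ ++ [n + 1])).Perm (List.range' 1 (n + 1)) := by
  have h0 : (List.range' 1 (n + 1)) = List.range' 1 n ++ [n + 1] := by
    rw [List.range'_1_concat, add_comm]
  have h1 : (s₁ ++ (s₂ ++ [n + 1])).Perm (List.range' 1 (n + 1)) := by
    rw [h0, ← List.append_assoc]; exact h.append_right _
  refine ⟨?_, h1⟩
  refine List.Perm.trans ?_ h1
  rw [List.append_assoc]
  exact List.perm_append_comm.append_left s₁

theorem Run.perm {w r₁ r₂ s₁ s₂ : List ℕ} (h : Run w r₁ r₂ s₁ s₂) : w.Perm (r₁ ++ r₂) := by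
  induction h with
  | nil => simp
  | app x h hx ih =>
    refine (ih.append_right [x]).trans ?_
    simp only [List.append_assoc]
    exact (List.perm_append_comm).append_left _
  | @bump w l₁ l₂ r₂ s₁ s₂ x y h h1 h2 h3 ih =>
    refine (ih.append_right [x]).trans ?_
    rw [List.perm_iff_count]
    intro a
    simp [List.count_append, List.count_cons]
    omega

theorem Run.mem_iff {w r₁ r₂ s₁ s₂ : List ℕ} (h : Run w r₁ r₂ s₁ s₂) (z : ℕ) :
    z ∈ w ↔ z ∈ r₁ ∨ z ∈ r₂ := by rw [h.perm.mem_iff, List.mem_append]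

theorem pairwise_split {l₁ l₂ : List ℕ} {y : ℕ} (h : (l₁ ++ y :: l₂).Pairwise (· < ·)) :
    l₁.Pairwise (· < ·) ∧ l₂.Pairwise (· < ·) ∧ (∀ z ∈ l₁, z < y) ∧ (∀ z ∈ l₂, y < z) ∧
      ∀ z ∈ l₁, ∀ u ∈ l₂, z < u := by
  simp only [List.pairwise_append, List.pairwise_cons, List.mem_cons, forall_eq_or_imp] at h
  exact ⟨h.1, h.2.1.2, fun z hz => (h.2.2 z hz).1, h.2.1.1, fun z hz => (h.2.2 z hz).2⟩

theorem pairwise_join {l₁ l₂ : List ℕ} {y : ℕ} (h1 : l₁.Pairwise (· < ·))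
    (h2 : l₂.Pairwise (· < ·)) (h3 : ∀ z ∈ l₁, z < y) (h4 : ∀ z ∈ l₂, y < z) :
    (l₁ ++ y :: l₂).Pairwise (· < ·) := by
  simp only [List.pairwise_append, List.pairwise_cons, List.mem_cons, forall_eq_or_imp]
  exact ⟨h1, ⟨h4, h2⟩, fun z hz => ⟨h3 z hz, fun u hu => (h3 z hz).trans (h4 u hu)⟩⟩

theorem Dominates.append_left {r₁ r₂ : List ℕ} (h : Dominates r₁ r₂) (l : List ℕ) :
    Dominates (r₁ ++ l) r₂ := by
  intro m; rw [List.countP_append]; exact (h m).trans (Nat.le_add_right _ _)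

theorem Dominates.append_right {r₁ r₂ : List ℕ} {y : ℕ} (h : Dominates r₁ r₂)
    (h1 : ∀ z ∈ r₁, z < y) (h2 : r₂.length + 1 ≤ r₁.length) : Dominates r₁ (r₂ ++ [y]) := by
  intro m
  have := h m
  rw [List.countP_append, List.countP_singleton]
  split_ifs with hm
  · have hm : y ≤ m := by simpa using hm
    rw [countP_le_eq_length (r := r₁) (fun z hz => (h1 z hz).le.trans hm)]
    have := List.countP_le_length (p := (fun z => decide (z ≤ m))) (l := r₂)
    omega
  · omega

/-- Dominance just below `y` gives `|r₂| ≤ |l₁|`, since all of `r₂` but only `l₁` from the first row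
lies there. This pays for the new entry `y` of the second row at every threshold from `y` on. -/
theorem Dominates.bump {l₁ l₂ r₂ : List ℕ} {x y : ℕ} (h : Dominates (l₁ ++ y :: l₂) r₂)
    (hs : (l₁ ++ y :: l₂).Pairwise (· < ·)) (hxy : x < y)
    (hr : ∀ z ∈ r₂, z < y) : Dominates (l₁ ++ x :: l₂) (r₂ ++ [y]) := by
  obtain ⟨-, -, a1, a2, -⟩ := pairwise_split hs
  intro m
  have hm := h m
  simp only [List.countP_append, List.countP_cons, List.countP_nil] at hm ⊢
  by_cases hy : y ≤ m
  · have e1 := countP_le_eq_length (r := l₁) (fun z hz => (a1 z hz).le.trans hy)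
    have e2 := countP_le_eq_length (r := r₂) (fun z hz => (hr z hz).le.trans hy)
    have h' := h (y - 1)
    rw [countP_le_eq_length (r := r₂) (fun z hz => Nat.le_sub_one_of_lt (hr z hz))] at h'
    simp only [List.countP_append, List.countP_cons] at h'
    rw [countP_le_eq_length (r := l₁) (fun z hz => Nat.le_sub_one_of_lt (a1 z hz)),
      countP_le_eq_zero (r := l₂) (fun z hz => (Nat.sub_le _ _).trans_lt (a2 z hz))] at h'
    have : ¬ y ≤ y - 1 := by omega
    simp only [this, hy, hxy.le.trans hy, decide_true, decide_false, if_true] at h' ⊢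
    simp at h'
    omega
  · simp only [hy, decide_false] at hm ⊢
    simp at hm ⊢
    omega

theorem Run.isPair {w r₁ r₂ s₁ s₂ : List ℕ} (h : Run w r₁ r₂ s₁ s₂) :
    IsPair w.length r₁ r₂ s₁ s₂ := by
  induction h with
  | nil => constructor <;> simp [Dominates]
  | @app w r₁ r₂ s₁ s₂ x h hx ih =>
    have hs : ∀ z ∈ s₁, z < w.length + 1 := fun z hz => by
      have := (ih.mem_iff z).1 (Or.inl hz); omega
    have h1 := ih.len; have h2 := ih.len₁; have h3 := ih.len₂
    constructor
    · simp; omega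
    · simp; omega
    · omega
    · exact pairwise_append_singleton ih.sr₁ hx
    · exact ih.sr₂
    · exact pairwise_append_singleton ih.ss₁ hs
    · exact ih.ss₂
    · simpa using (perm_range'_succ ih.perm).1
    · exact ih.dr.append_left _
    · exact ih.ds.append_left _
  | @bump w l₁ l₂ r₂ s₁ s₂ x y h h1 h2 h3 ih =>
    have hs : ∀ z, z ∈ s₁ ∨ z ∈ s₂ → z < w.length + 1 := fun z hz => by
      have := (ih.mem_iff z).1 hz; omega
    have e1 := ih.len; have e2 := ih.len₁; have e3 := ih.len₂
    obtain ⟨a0, a0', a1, a2, -⟩ := pairwise_split ih.sr₁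
    have hd := ih.dr.bump ih.sr₁ h2 h3
    have hl := hd.length_le
    simp only [List.length_append, List.length_cons, List.length_nil] at *
    constructor
    · simp; omega
    · simp; omega
    · simp; omega
    · exact pairwise_join a0 a0' h1 (fun z hz => h2.trans (a2 z hz))
    · exact pairwise_append_singleton ih.sr₂ h3
    · exact ih.ss₁
    · exact pairwise_append_singleton ih.ss₂ (fun z hz => hs z (Or.inr hz))
    · simpa using (perm_range'_succ ih.perm).2
    · exact hd
    -- The recording rows have the same lengths as the insertion rows, and dominance of the latter
    -- after the bump supplies the strict inequality needed here.
    · exact ih.ds.append_right (fun z hz => hs z (Or.inl hz)) (by omega)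

theorem Run.rsk_eq {w r₁ r₂ s₁ s₂ : List ℕ} (h : Run w r₁ r₂ s₁ s₂) :
    rsk w = (twoRows r₁ r₂, twoRows s₁ s₂) := by
  induction h with
  | nil => simp [rsk, twoRows]
  | @app w r₁ r₂ s₁ s₂ x h hx ih =>
    have hp := h.isPair
    have h2 := hp.len₁; have h3 := hp.len₂; have h4 := hp.dr.length_le
    have hr := rowInsert_append (fun z hz => (hx z hz).le)
    rw [rsk_append_singleton, ih]
    rcases r₁ with _ | ⟨a, r₁⟩ <;> rcases s₁ with _ | ⟨b, s₁⟩ <;> rcases r₂ with _ | ⟨c, r₂⟩ <;>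
      rcases s₂ with _ | ⟨e, s₂⟩ <;> simp at h2 h3 h4 <;>
      simp [twoRows, rskStep, tabInsert, addCell]
    all_goals simp [hr, addCell]
  | @bump w l₁ l₂ r₂ s₁ s₂ x y h h1 h2 h3 ih =>
    have hp := h.isPair
    have e2 := hp.len₁; have e3 := hp.len₂; have e4 := hp.dr.length_le
    have hr := rowInsert_bump (l₂ := l₂) h2 (fun z hz => (h1 z hz).le)
    have hr' := rowInsert_append (fun z hz => (h3 z hz).le)
    rw [rsk_append_singleton, ih]
    generalize hL : l₁ ++ y :: l₂ = L at *
    generalize hL' : l₁ ++ x :: l₂ = L' at *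
    have : L ≠ [] := by subst hL; simp
    have : L' ≠ [] := by subst hL'; simp
    rcases L with _ | ⟨a, r₁⟩ <;> rcases L' with _ | ⟨a', r₁'⟩ <;> rcases s₁ with _ | ⟨b, s₁⟩ <;>
      rcases r₂ with _ | ⟨c, r₂⟩ <;>
      rcases s₂ with _ | ⟨e, s₂⟩ <;> simp at e2 e3 e4 <;> try contradiction
    all_goals simp [twoRows, rskStep, tabInsert, addCell, hr, hr']

/-- Inversion with explicit equations, so that it applies when the word and the rows are compound
lists. -/
theorem Run.inv {w r₁ r₂ s₁ s₂ : List ℕ} (h : Run w r₁ r₂ s₁ s₂) :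
    (w = [] ∧ r₁ = [] ∧ r₂ = [] ∧ s₁ = [] ∧ s₂ = []) ∨
    (∃ w' r₁' s₁' x, w = w' ++ [x] ∧ r₁ = r₁' ++ [x] ∧ s₁ = s₁' ++ [w'.length + 1] ∧
      Run w' r₁' r₂ s₁' s₂ ∧ ∀ z ∈ r₁', z < x) ∨
    (∃ w' l₁ l₂ r₂' s₂' x y, w = w' ++ [x] ∧ r₁ = l₁ ++ x :: l₂ ∧ r₂ = r₂' ++ [y] ∧
      s₂ = s₂' ++ [w'.length + 1] ∧ Run w' (l₁ ++ y :: l₂) r₂' s₁ s₂' ∧ (∀ z ∈ l₁, z < x) ∧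
      x < y ∧ ∀ z ∈ r₂', z < y) := by
  cases h with
  | nil => simp
  | app x h hx => exact Or.inr (Or.inl ⟨_, _, _, x, rfl, rfl, rfl, h, hx⟩)
  | bump x y h h1 h2 h3 => exact Or.inr (Or.inr ⟨_, _, _, _, _, x, y, rfl, rfl, rfl, rfl, h, h1, h2, h3⟩)

theorem append_singleton_inj {l l' : List ℕ} {a b : ℕ} (h : l ++ [a] = l' ++ [b]) :
    l = l' ∧ a = b := by simpa using h

/-- Recovers the place of a bump from its outcome: the inserted letter is the last entry of the new
row below the bumped `y`. -/
theorem filter_lt_split {l₁ l₂ : List ℕ} {x y : ℕ} (h1 : ∀ z ∈ l₁, z < x) (h2 : x < y)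
    (h3 : ∀ z ∈ l₂, y < z) : (l₁ ++ x :: l₂).filter (· < y) = l₁ ++ [x] := by
  have e1 : l₁.filter (· < y) = l₁ := by
    rw [List.filter_eq_self]; intro z hz; simpa using (h1 z hz).trans h2
  have e2 : l₂.filter (· < y) = [] := by
    rw [List.filter_eq_nil_iff]; intro z hz; simpa using (h3 z hz).le
  simp [List.filter_append, e1, h2, e2]

/-- The last step can be undone in only one way. The row containing the largest recorded position
tells whether a letter was appended or bumped. In a bump, `y` ends the second row and the letter is
the largest first-row entry below `y`. -/
theorem Run.unique {w r₁ r₂ s₁ s₂ : List ℕ} (h : Run w r₁ r₂ s₁ s₂) :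
    ∀ {w' : List ℕ}, Run w' r₁ r₂ s₁ s₂ → w = w' := by
  induction h with
  | nil =>
    intro w' h'
    have := h'.isPair.len
    simp at this
    simp [← List.length_eq_zero_iff, ← this]
  | @app w r₁ r₂ s₁ s₂ x h hx ih =>
    intro w' h'
    have hp := (Run.app x h hx).isPair
    have hl : w'.length = w.length + 1 := by
      have a := hp.len; have b := h'.isPair.len; simp at a b ⊢; omega
    rcases h'.inv with ⟨rfl, _⟩ | ⟨v, t₁, u₁, x', rfl, e1, e2, hr, _⟩ |
      ⟨v, l₁, l₂, t₂, u₂, x', y', rfl, e1, e2, e3, hr, _⟩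
    · simp at hl
    · obtain ⟨rfl, rfl⟩ := append_singleton_inj e1
      obtain ⟨rfl, -⟩ := append_singleton_inj e2
      rw [ih hr]
    · have := (hr.isPair.mem_iff (w.length + 1)).1 (Or.inl (by simp))
      simp at hl
      omega
  | @bump w l₁ l₂ r₂ s₁ s₂ x y h h1 h2 h3 ih =>
    intro w' h'
    have hp := (Run.bump x y h h1 h2 h3).isPair
    have hl : w'.length = w.length + 1 := by
      have a := hp.len; have b := h'.isPair.len; simp at a b ⊢; omega
    rcases h'.inv with ⟨rfl, _⟩ | ⟨v, t₁, u₁, x', rfl, e1, e2, hr, _⟩ |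
      ⟨v, k₁, k₂, t₂, u₂, x', y', rfl, e1, e2, e3, hr, g1, g2, g3⟩
    · simp at hl
    · have := (hr.isPair.mem_iff (w.length + 1)).1 (Or.inr (by simp))
      simp at hl
      omega
    · obtain ⟨rfl, rfl⟩ := append_singleton_inj e2
      obtain ⟨rfl, -⟩ := append_singleton_inj e3
      have f1 := filter_lt_split h1 h2 (pairwise_split h.isPair.sr₁).2.2.2.1
      have f2 := filter_lt_split g1 g2 (pairwise_split hr.isPair.sr₁).2.2.2.1
      rw [e1, f2] at f1
      obtain ⟨rfl, rfl⟩ := append_singleton_inj f1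
      simp at e1
      subst e1
      rw [ih hr]

/-! ### Avoiding 321 is the same as never needing a third row. -/

theorem concat_sublist_concat {l w : List ℕ} {z x : ℕ} (h : (l ++ [z]).Sublist (w ++ [x])) :
    (l ++ [z]).Sublist w ∨ (z = x ∧ l.Sublist w) := by
  rw [← List.reverse_sublist] at h
  simp only [List.reverse_append, List.reverse_cons, List.reverse_nil, List.nil_append,
    List.singleton_append] at h
  rcases List.sublist_cons_iff.1 h with h | ⟨r, h1, h2⟩
  · left
    rw [← List.reverse_sublist]; simpa using h
  · right
    simp only [List.cons.injEq] at h1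
    obtain ⟨rfl, rfl⟩ := h1
    exact ⟨rfl, List.reverse_sublist.1 h2⟩

/-- A word without a decreasing subsequence of length three. -/
def WordAvoids (w : List ℕ) : Prop := ∀ a b c, [a, b, c].Sublist w → b < a → c < b → False

theorem sublist_pair {w : List ℕ} {z x : ℕ} (hz : z ∈ w) : [z, x].Sublist (w ++ [x]) :=
  (List.singleton_sublist.2 hz).append (List.Sublist.refl [x])

theorem Sublist.concat {l w : List ℕ} (h : l.Sublist w) (x : ℕ) : l.Sublist (w ++ [x]) :=
  h.trans (List.sublist_append_left _ _)

/-- If a first-row entry `y` lies below a second-row entry, then a later letter smaller than `y`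
completes the inversion found here to a decreasing triple. -/
theorem Run.exists_inversion {w r₁ r₂ s₁ s₂ : List ℕ} (h : Run w r₁ r₂ s₁ s₂) :
    ∀ z ∈ r₂, ∀ y ∈ r₁, y < z → ∃ a b, [a, b].Sublist w ∧ b < a ∧ y ≤ b := by
  induction h with
  | nil => simp
  | @app w r₁ r₂ s₁ s₂ x h hx ih =>
    intro z hz y hy hyz
    rcases List.mem_append.1 hy with hy | hy
    · obtain ⟨a, b, h1, h2⟩ := ih z hz y hy hyz
      exact ⟨a, b, Sublist.concat h1 x, h2⟩
    · obtain rfl := List.mem_singleton.1 hy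
      exact ⟨z, y, sublist_pair ((h.mem_iff z).2 (Or.inr hz)), hyz, le_rfl⟩
  | @bump w l₁ l₂ r₂ s₁ s₂ x y₀ h h1 h2 h3 ih =>
    obtain ⟨-, -, a1, a2, -⟩ := pairwise_split h.isPair.sr₁
    intro z hz y hy hyz
    rcases List.mem_append.1 hz with hz | hz
    · by_cases hyx : y = x
      · subst hyx
        exact ⟨z, y, sublist_pair ((h.mem_iff z).2 (Or.inr hz)), hyz, le_rfl⟩
      · obtain ⟨a, b, h1, h2⟩ := ih z hz y (by simp at hy ⊢; tauto) hyz
        exact ⟨a, b, Sublist.concat h1 x, h2⟩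
    · obtain rfl := List.mem_singleton.1 hz
      have hyx : y ≤ x := by
        simp only [List.mem_append, List.mem_cons] at hy
        rcases hy with hy | rfl | hy
        · exact (h1 y hy).le
        · exact le_rfl
        · exact absurd (a2 y hy) (by omega)
      exact ⟨z, x, sublist_pair ((h.mem_iff z).2 (Or.inl (by simp))), h2, hyx⟩

theorem exists_run {w : List ℕ} (hn : w.Nodup) (ha : WordAvoids w) :
    ∃ r₁ r₂ s₁ s₂, Run w r₁ r₂ s₁ s₂ := by
  induction w using List.reverseRecOn with
  | nil => exact ⟨_, _, _, _, Run.nil⟩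
  | append_singleton w x ih =>
    have hn' : w.Nodup ∧ x ∉ w := by
      rw [List.nodup_append] at hn
      exact ⟨hn.1, fun hx => hn.2.2 x hx x (by simp) rfl⟩
    obtain ⟨r₁, r₂, s₁, s₂, h⟩ := ih hn'.1 (fun a b c habc => ha a b c (Sublist.concat habc x))
    have hne : ∀ z ∈ w, z ≠ x := fun z hz e => hn'.2 (e ▸ hz)
    have hnd : (r₁ ++ r₂).Nodup := h.perm.nodup_iff.1 hn'.1
    rcases exists_first_gt x r₁ with h1 | ⟨l₁, y, l₂, rfl, h1, h2⟩
    · exact ⟨_, _, _, _, Run.app x h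
        (fun z hz => lt_of_le_of_ne (h1 z hz) (hne z ((h.mem_iff z).2 (Or.inl hz))))⟩
    · refine ⟨_, _, _, _, Run.bump x y h (fun z hz => lt_of_le_of_ne (h1 z hz)
        -- If the bumped `y` were smaller than some second-row entry, an inversion ending at or
        -- above `y` would be followed by `x < y`. This is the only use of avoidance of 321.
        (hne z ((h.mem_iff z).2 (Or.inl (by simp [hz]))))) h2 (fun z hz => ?_)⟩
      by_contra hzy
      have hyz : y < z := by
        refine lt_of_le_of_ne (not_lt.1 hzy) ?_
        rintro rfl
        rw [List.nodup_append] at hnd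
        exact hnd.2.2 y (by simp) y hz rfl
      obtain ⟨a, b, h4, h5, h6⟩ := h.exists_inversion z hz y (by simp) hyz
      exact ha a b x (h4.append (List.Sublist.refl [x])) h5 (by omega)

/-- Converse of `exists_inversion`. The witness in the first row survives later bumps because a
bumped entry exceeds the whole second row, whereas `y < z`. -/
theorem Run.inversion_bound {w r₁ r₂ s₁ s₂ : List ℕ} (h : Run w r₁ r₂ s₁ s₂) :
    ∀ a b, [a, b].Sublist w → b < a → ∃ y ∈ r₁, ∃ z ∈ r₂, b ≤ y ∧ y < z := by
  induction h with
  | nil => simp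
  | @app w r₁ r₂ s₁ s₂ x h hx ih =>
    intro a b hab hlt
    rcases concat_sublist_concat (l := [a]) hab with hab | ⟨rfl, ha⟩
    · obtain ⟨y, hy, z, hz, h1⟩ := ih a b hab hlt
      exact ⟨y, by simp [hy], z, hz, h1⟩
    · refine ⟨b, by simp, a, ?_, le_rfl, hlt⟩
      rcases (h.mem_iff a).1 (List.singleton_sublist.1 ha) with h1 | h1
      · exact absurd (hx a h1) (by omega)
      · exact h1
  | @bump w l₁ l₂ r₂ s₁ s₂ x y₀ h h1 h2 h3 ih =>
    intro a b hab hlt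
    rcases concat_sublist_concat (l := [a]) hab with hab | ⟨rfl, ha⟩
    · obtain ⟨y, hy, z, hz, h4, h5⟩ := ih a b hab hlt
      have : y ≠ y₀ := by rintro rfl; exact absurd (h3 z hz) (by omega)
      exact ⟨y, by simp at hy ⊢; tauto, z, by simp [hz], h4, h5⟩
    · exact ⟨b, by simp, y₀, by simp, le_rfl, h2⟩

/-- For a new letter below an inversion, take the pair `y < z` that bounds the inversion. Then `y`
exceeds the new letter, so it is at or beyond the bumped entry, which in turn exceeds `z`: a
contradiction. -/
theorem Run.wordAvoids {w r₁ r₂ s₁ s₂ : List ℕ} (h : Run w r₁ r₂ s₁ s₂) : WordAvoids w := by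
  induction h with
  | nil => intro a b c h; simp at h
  | @app w r₁ r₂ s₁ s₂ x h hx ih =>
    intro a b c habc hab hbc
    rcases concat_sublist_concat (l := [a, b]) habc with habc | ⟨rfl, h1⟩
    · exact ih a b c habc hab hbc
    · obtain ⟨y, hy, z, hz, h2, h3⟩ := h.inversion_bound a b h1 hab
      exact absurd (hx y hy) (by omega)
  | @bump w l₁ l₂ r₂ s₁ s₂ x y₀ h h1 h2 h3 ih =>
    obtain ⟨-, -, a1, a2, -⟩ := pairwise_split h.isPair.sr₁
    intro a b c habc hab hbc
    rcases concat_sublist_concat (l := [a, b]) habc with habc | ⟨rfl, h4⟩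
    · exact ih a b c habc hab hbc
    · obtain ⟨y, hy, z, hz, h5, h6⟩ := h.inversion_bound a b h4 hab
      have h7 := h3 z hz
      simp only [List.mem_append, List.mem_cons] at hy
      rcases hy with hy | rfl | hy
      · exact absurd (h1 y hy) (by omega)
      · omega
      · exact absurd (a2 y hy) (by omega)

/-! ### Reverse insertion. -/

theorem exists_eq_concat_of_max {s : List ℕ} {n : ℕ} (hs : s.Pairwise (· < ·)) (hn : n ∈ s)
    (hm : ∀ z ∈ s, z ≤ n) : ∃ t, s = t ++ [n] := by
  rcases List.eq_nil_or_concat s with rfl | ⟨t, a, rfl⟩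
  · simp at hn
  · have hn : n ∈ t ∨ n = a := by simpa using hn
    rcases hn with hn | rfl
    · have h1 : n < a := by
        rw [List.concat_eq_append, List.pairwise_append] at hs
        exact hs.2.2 n hn a (by simp)
      exact absurd (hm a (by simp)) (by omega)
    · exact ⟨t, by simp⟩

theorem exists_split_at {r : List ℕ} {y : ℕ} (hr : r.Pairwise (· < ·)) (hy : y ∉ r) :
    ∃ l l', r = l ++ l' ∧ (∀ z ∈ l, z < y) ∧ ∀ z ∈ l', y < z := by
  induction r with
  | nil => exact ⟨[], [], by simp⟩
  | cons a r ih =>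
    rw [List.pairwise_cons] at hr
    by_cases h : y < a
    · exact ⟨[], a :: r, by simp, by simp, by
        simpa [h] using fun z hz => h.trans (hr.1 z hz)⟩
    · obtain ⟨l, l', rfl, h1, h2⟩ := ih hr.2 (fun h' => hy (by simp [h']))
      have : a ≠ y := fun h' => hy (by simp [h'])
      exact ⟨a :: l, l', by simp, by simpa using ⟨by omega, h1⟩, h2⟩

theorem pairwise_of_concat {r : List ℕ} {x : ℕ} (h : (r ++ [x]).Pairwise (· < ·)) :
    r.Pairwise (· < ·) ∧ ∀ z ∈ r, z < x := by
  obtain ⟨h1, -, h2, -⟩ := pairwise_split h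
  exact ⟨h1, h2⟩

/-- Undo one insertion according to the row of the recording tableau that contains the largest
position. The entries of `r₁` and `r₂` are only required to be distinct, since `{1, …, n}` is not
preserved when a letter is removed. -/
theorem exists_run_of_isPair {n : ℕ} : ∀ {r₁ r₂ s₁ s₂ : List ℕ}, IsPair n r₁ r₂ s₁ s₂ →
    (r₁ ++ r₂).Nodup → ∃ w, Run w r₁ r₂ s₁ s₂ := by
  induction n with
  | zero =>
    intro r₁ r₂ s₁ s₂ h _
    have h1 := h.len; have h2 := h.len₁; have h3 := h.len₂
    obtain rfl : r₁ = [] := List.length_eq_zero_iff.1 (by omega)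
    obtain rfl : r₂ = [] := List.length_eq_zero_iff.1 (by omega)
    obtain rfl : s₁ = [] := List.length_eq_zero_iff.1 (by simpa using h2)
    obtain rfl : s₂ = [] := List.length_eq_zero_iff.1 (by simpa using h3)
    exact ⟨[], Run.nil⟩
  | succ n ih =>
    intro r₁ r₂ s₁ s₂ h hnd
    have e1 := h.len; have e2 := h.len₁; have e3 := h.len₂
    rcases (h.mem_iff (n + 1)).2 ⟨by omega, le_rfl⟩ with hm | hm
    · obtain ⟨t, rfl⟩ := exists_eq_concat_of_max h.ss₁ hm
        (fun z hz => ((h.mem_iff z).1 (Or.inl hz)).2)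
      rcases List.eq_nil_or_concat r₁ with rfl | ⟨r, x, rfl⟩
      · simp at e2
      rw [List.concat_eq_append] at *
      obtain ⟨p1, p2⟩ := pairwise_of_concat h.sr₁
      obtain ⟨p3, p4⟩ := pairwise_of_concat h.ss₁
      simp only [List.length_append, List.length_singleton] at e1 e2
      have hperm : (t ++ s₂).Perm (List.range' 1 n) := by
        have := h.perm
        rw [List.range'_1_concat, add_comm 1 n] at this
        refine (List.perm_append_right_iff [n + 1]).1 (List.Perm.trans ?_ this)
        simp only [List.append_assoc]
        exact List.perm_append_comm.append_left t
      have hs2 : ∀ z ∈ s₂, z ≤ n := fun z hz => by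
        have := hperm.mem_iff.1 (List.mem_append_right t hz)
        rw [List.mem_range'_1] at this; omega
      have hds : Dominates t s₂ := by
        intro m
        -- At thresholds up to `n` the removed entry `n + 1` does not contribute to the count.
        have := h.ds (min m n)
        have g : ∀ l : List ℕ, (∀ z ∈ l, z ≤ n) → l.countP (· ≤ min m n) = l.countP (· ≤ m) := by
          intro l hl
          refine List.countP_congr fun z hz => ?_
          have := hl z hz; simp; omega
        rw [g s₂ hs2, List.countP_append, g t (fun z hz => Nat.lt_succ_iff.1 (p4 z hz))] at this
        simpa using this
      have hdl := hds.length_le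
      have hdr : Dominates r r₂ := by
        intro m
        have := h.dr m
        rw [List.countP_append, List.countP_singleton] at this
        split_ifs at this with hx
        · rw [countP_le_eq_length (r := r) (fun z hz => (p2 z hz).le.trans (by simpa using hx))]
          exact List.countP_le_length.trans (by omega)
        · omega
      obtain ⟨w, hw⟩ := ih (r₁ := r) (r₂ := r₂) (s₁ := t) (s₂ := s₂)
        ⟨by omega, by omega, e3, p1, h.sr₂, p3, h.ss₂, hperm, hdr, hds⟩
        (hnd.sublist ((List.sublist_append_left r [x]).append (List.Sublist.refl r₂)))
      have hwl : w.length = n := by rw [← hw.isPair.len]; omega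
      exact ⟨w ++ [x], hwl ▸ Run.app x hw p2⟩
    · obtain ⟨t, rfl⟩ := exists_eq_concat_of_max h.ss₂ hm
        (fun z hz => ((h.mem_iff z).1 (Or.inr hz)).2)
      rcases List.eq_nil_or_concat r₂ with rfl | ⟨r, y, rfl⟩
      · simp at e3
      rw [List.concat_eq_append] at *
      obtain ⟨p1, p2⟩ := pairwise_of_concat h.sr₂
      obtain ⟨p3, p4⟩ := pairwise_of_concat h.ss₂
      simp only [List.length_append, List.length_singleton] at e1 e3
      have hperm : (s₁ ++ t).Perm (List.range' 1 n) := by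
        have := h.perm
        rw [List.range'_1_concat, add_comm 1 n, ← List.append_assoc,
          List.perm_append_right_iff] at this
        exact this
      have hyr : y ∉ r₁ := by
        rw [List.nodup_append] at hnd
        exact fun hy => hnd.2.2 y hy y (by simp) rfl
      have hdis : ∀ a ∈ r₁, ∀ b ∈ r, a ≠ b := by
        rw [List.nodup_append] at hnd
        exact fun a ha b hb => hnd.2.2 a ha b (by simp [hb])
      obtain ⟨l, l₂, rfl, q1, q2⟩ := exists_split_at h.sr₁ hyr
      -- Dominance at `y` says that more than `|r|` first-row entries lie below `y`. In particular
      -- there is one, and the largest is the letter `x` that bumped `y`.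
      have hy0 := h.dr y
      rw [List.countP_append, List.countP_append, countP_le_eq_zero q2,
        countP_le_eq_length (fun z hz => (p2 z hz).le),
        countP_le_eq_length (fun z hz => (q1 z hz).le)] at hy0
      simp at hy0
      rcases List.eq_nil_or_concat l with rfl | ⟨l₁, x, rfl⟩
      · simp at hy0
      rw [List.concat_eq_append] at *
      simp only [List.append_assoc, List.singleton_append] at *
      obtain ⟨a0, a0', a1, a2, a3⟩ := pairwise_split h.sr₁
      have hxy : x < y := q1 x (by simp)
      have hds : Dominates s₁ t := by
        intro m
        have := h.ds m
        rw [List.countP_append] at this; omega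
      have hdr : Dominates (l₁ ++ y :: l₂) r := by
        intro m
        have hm := h.dr m
        simp only [List.countP_append, List.countP_cons, List.countP_nil] at hm ⊢
        by_cases hy : y ≤ m
        · have : x ≤ m := hxy.le.trans hy
          simp only [hy, this, decide_true, if_true] at hm ⊢
          omega
        · by_cases hx : x ≤ m
          · rw [countP_le_eq_length (r := l₁) (fun z hz => (a1 z hz).le.trans hx)]
            have := List.countP_le_length (p := (fun z => decide (z ≤ m))) (l := r)
            simp at hy0
            omega
          · simp only [hy, hx] at hm ⊢
            simp at hm ⊢
            omega
      have hsr : (l₁ ++ y :: l₂).Pairwise (· < ·) :=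
        pairwise_join a0 a0' (fun z hz => (a1 z hz).trans hxy) q2
      have hnd' : ((l₁ ++ y :: l₂) ++ r).Nodup := by
        rw [List.nodup_append]
        refine ⟨hsr.imp (fun h => ne_of_lt h), p1.imp (fun h => ne_of_lt h), ?_⟩
        intro a ha b hb
        have hbp := p2 b hb
        simp only [List.mem_append, List.mem_cons] at ha
        rcases ha with ha | rfl | ha
        · exact hdis a (List.mem_append_left _ ha) b hb
        · omega
        · exact hdis a (List.mem_append_right _ (List.mem_cons_of_mem _ ha)) b hb
      simp only [List.length_append, List.length_cons] at e1 e2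
      obtain ⟨w, hw⟩ := ih (r₁ := l₁ ++ y :: l₂) (r₂ := r) (s₁ := s₁) (s₂ := t)
        ⟨by simp; omega, by simp; omega, by omega, hsr, p1, h.ss₁, p3, hperm, hdr, hds⟩ hnd'
      have hwl : w.length = n := by rw [← hw.isPair.len]; simp; omega
      exact ⟨w ++ [x], hwl ▸ Run.bump x y hw a1 hxy p2⟩

/-! ### Longest increasing subsequences and the first row. -/

/-- When a letter enters column `j`, it extends a subsequence ending at its left neighbour, which is
smaller and was read earlier. -/
theorem Run.exists_increasing {w r₁ r₂ s₁ s₂ : List ℕ} (h : Run w r₁ r₂ s₁ s₂) :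
    ∀ j z, r₁[j]? = some z →
      ∃ s, (s ++ [z]).Sublist w ∧ (s ++ [z]).Pairwise (· < ·) ∧ s.length = j := by
  have key : ∀ {w : List ℕ} {x : ℕ} (l : List ℕ), (∀ z ∈ l, z < x) →
      (∀ j z, l[j]? = some z →
        ∃ s, (s ++ [z]).Sublist w ∧ (s ++ [z]).Pairwise (· < ·) ∧ s.length = j) →
      ∃ s, (s ++ [x]).Sublist (w ++ [x]) ∧ (s ++ [x]).Pairwise (· < ·) ∧ s.length = l.length := by
    intro w x l hl ih
    rcases List.eq_nil_or_concat l with rfl | ⟨l, u, rfl⟩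
    · exact ⟨[], by simp⟩
    · obtain ⟨s, h1, h2, h3⟩ := ih l.length u (by simp)
      refine ⟨s ++ [u], h1.append (List.Sublist.refl [x]), pairwise_append_singleton h2 ?_, by simp [h3]⟩
      obtain ⟨-, h4⟩ := pairwise_of_concat h2
      have hu := hl u (by simp)
      intro z hz
      rcases List.mem_append.1 hz with hz | hz
      · exact (h4 z hz).trans hu
      · rw [List.mem_singleton.1 hz]; exact hu
  induction h with
  | nil => simp
  | @app w r₁ r₂ s₁ s₂ x h hx ih =>
    intro j z hj
    rcases lt_trichotomy j r₁.length with hlt | rfl | hgt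
    · rw [List.getElem?_append_left hlt] at hj
      obtain ⟨s, h1, h2⟩ := ih j z hj
      exact ⟨s, Sublist.concat h1 x, h2⟩
    · obtain rfl : x = z := by simpa using hj
      exact key r₁ hx ih
    · rw [List.getElem?_eq_none (by simp; omega)] at hj; simp at hj
  | @bump w l₁ l₂ r₂ s₁ s₂ x y₀ h h1 h2 h3 ih =>
    intro j z hj
    rcases eq_or_ne j l₁.length with rfl | hne
    · obtain rfl : x = z := by simpa using hj
      refine key l₁ h1 (fun j z hj => ih j z ?_)
      rw [List.getElem?_append_left (List.getElem?_eq_some_iff.1 hj).1]; exact hj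
    · obtain ⟨s, h1, h2⟩ := ih j z (by
        rw [← hj, List.getElem?_append, List.getElem?_append]
        split_ifs with hlt
        · rfl
        · obtain ⟨i, hi⟩ : ∃ i, j - l₁.length = i + 1 := ⟨j - l₁.length - 1, by omega⟩
          rw [hi]; simp)
      exact ⟨s, Sublist.concat h1 x, h2⟩

/-- Each column of the first row holds the least possible last letter of an increasing subsequence
of the corresponding length. A letter ending a subsequence exceeds the entry one column before,
hence is inserted at that subsequence's column or further right. -/
theorem Run.increasing_bound {w r₁ r₂ s₁ s₂ : List ℕ} (h : Run w r₁ r₂ s₁ s₂) :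
    ∀ s z, (s ++ [z]).Sublist w → (s ++ [z]).Pairwise (· < ·) →
      ∃ u, r₁[s.length]? = some u ∧ u ≤ z := by
  induction h with
  | nil => intro s z h; simp at h
  | @app w r₁ r₂ s₁ s₂ x h hx ih =>
    have ih' : ∀ s z, (s ++ [z]).Sublist w → (s ++ [z]).Pairwise (· < ·) →
      ∃ u, (r₁ ++ [x])[s.length]? = some u ∧ u ≤ z := by
      intro s z h1 h2
      obtain ⟨u, hu, huz⟩ := ih s z h1 h2
      exact ⟨u, by rw [List.getElem?_append_left (List.getElem?_eq_some_iff.1 hu).1]; exact hu, huz⟩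
    have hall : ∀ j, j ≤ r₁.length → ∃ u, (r₁ ++ [x])[j]? = some u ∧ u ≤ x := by
      intro j hj
      rcases hj.lt_or_eq with hj | rfl
      · exact ⟨r₁[j], by simp [List.getElem?_append_left hj, hj], (hx _ (by simp)).le⟩
      · exact ⟨x, by simp⟩
    intro s z hs hp
    rcases concat_sublist_concat hs with hs' | ⟨rfl, hs'⟩
    · exact ih' s z hs' hp
    · rcases List.eq_nil_or_concat s with rfl | ⟨s, u, rfl⟩
      · exact hall 0 (by omega)
      · rw [List.concat_eq_append] at *
        obtain ⟨v, hv, -⟩ := ih s u hs' (pairwise_of_concat hp).1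
        have := (List.getElem?_eq_some_iff.1 hv).1
        exact hall _ (by simp; omega)
  | @bump w l₁ l₂ r₂ s₁ s₂ x y₀ h h1 h2 h3 ih =>
    obtain ⟨-, -, a1, a2, -⟩ := pairwise_split h.isPair.sr₁
    have hall : ∀ j, j ≤ l₁.length → ∃ u, (l₁ ++ x :: l₂)[j]? = some u ∧ u ≤ x := by
      intro j hj
      rcases hj.lt_or_eq with hj | rfl
      · exact ⟨l₁[j], by simp [List.getElem?_append_left hj, hj], (h1 _ (by simp)).le⟩
      · exact ⟨x, by simp⟩
    intro s z hs hp
    rcases concat_sublist_concat hs with hs' | ⟨rfl, hs'⟩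
    · obtain ⟨u, hu, huz⟩ := ih s z hs' hp
      rcases le_or_gt s.length l₁.length with hl | hl
      · rcases hl.lt_or_eq with hl | hl
        · rw [List.getElem?_append_left hl] at hu
          exact ⟨u, by rw [List.getElem?_append_left hl]; exact hu, huz⟩
        · obtain rfl : y₀ = u := by simpa [hl] using hu
          exact ⟨x, by simp [hl], by omega⟩
      · refine ⟨u, ?_, huz⟩
        rw [← hu, List.getElem?_append, List.getElem?_append]
        obtain ⟨i, hi⟩ : ∃ i, s.length - l₁.length = i + 1 := ⟨s.length - l₁.length - 1, by omega⟩
        rw [hi]; simp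
    · rcases List.eq_nil_or_concat s with rfl | ⟨s, u, rfl⟩
      · exact hall 0 (by omega)
      · rw [List.concat_eq_append] at *
        obtain ⟨p1, p2⟩ := pairwise_of_concat hp
        obtain ⟨v, hv, hvu⟩ := ih s u hs' p1
        have hux := p2 u (by simp)
        refine hall _ ?_
        -- Otherwise `v` is the bumped entry or lies to its right, so `x < v`, against `v ≤ u < x`.
        by_contra hcon
        have hlen : l₁.length ≤ s.length := by simp at hcon; omega
        rw [List.getElem?_append_right hlen] at hv
        have hmem := List.mem_of_getElem? hv
        simp only [List.mem_cons] at hmem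
        rcases hmem with rfl | hmem
        · omega
        · have := a2 v hmem; omega

/-! ### Descents and the recording tableau. -/

theorem Run.last_letter {w r₁ r₂ s₁ s₂ : List ℕ} {u : ℕ} (h : Run (w ++ [u]) r₁ r₂ s₁ s₂) :
    u ∈ r₁ ∧ ((w.length + 1 ∈ s₁ ∧ ∀ z ∈ r₁, z ≤ u) ∨ (w.length + 1 ∉ s₁ ∧ ∃ z ∈ r₂, u < z)) := by
  rcases h.inv with ⟨h, -⟩ | ⟨w', r, s, x, e1, rfl, rfl, h1, h2⟩ |
    ⟨w', l₁, l₂, r, s, x, y, e1, rfl, rfl, rfl, h1, h2, h3, h4⟩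
  · simp at h
  · obtain ⟨rfl, rfl⟩ := append_singleton_inj e1
    refine ⟨by simp, Or.inl ⟨by simp, ?_⟩⟩
    intro z hz
    rcases List.mem_append.1 hz with hz | hz
    · exact (h2 z hz).le
    · rw [List.mem_singleton.1 hz]
  · obtain ⟨rfl, rfl⟩ := append_singleton_inj e1
    refine ⟨by simp, Or.inr ⟨?_, y, by simp, h3⟩⟩
    intro h5
    have := (h1.isPair.mem_iff _).1 (Or.inl h5)
    omega

/-- Only the last two letters `u`, `x` matter. An appended `x` exceeds `u`. If `x` bumps and `u` was
appended, then `u` is the row maximum and `x < u`. If both bump, a descent would make the second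
bumped entry at most `u`, hence below the first one, which is impossible with two rows. The index
`i` is 0-based and the recorded positions are 1-based. -/
theorem Run.descent_iff {w r₁ r₂ s₁ s₂ : List ℕ} (h : Run w r₁ r₂ s₁ s₂) :
    ∀ i a b, w[i]? = some a → w[i + 1]? = some b →
      (b < a ↔ i + 1 ∈ s₁ ∧ i + 2 ∉ s₁) := by
  induction h with
  | nil => simp
  | @app w r₁ r₂ s₁ s₂ x h hx ih =>
    intro i a b ha hb
    have hlt := (List.getElem?_eq_some_iff.1 hb).1
    simp only [List.length_append, List.length_singleton] at hlt
    rw [List.getElem?_append_left (by omega)] at ha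
    rcases Nat.lt_or_ge (i + 1) w.length with hi | hi
    · rw [List.getElem?_append_left hi] at hb
      rw [ih i a b ha hb]
      have h1 : i + 1 ≠ w.length + 1 := by omega
      have h2 : i + 2 ≠ w.length + 1 := by omega
      simp [h2, show i ≠ w.length by omega]
    · have hi : i + 1 = w.length := by omega
      obtain rfl : x = b := by simpa [hi] using hb
      have ham : a < x := by
        rcases List.eq_nil_or_concat w with rfl | ⟨w, u, rfl⟩
        · simp at hi
        rw [List.concat_eq_append] at *
        obtain rfl : u = a := by
          have : i = w.length := by simpa using hi
          simpa [this] using ha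
        exact hx u h.last_letter.1
      constructor
      · intro h; omega
      · rintro ⟨-, h2⟩
        exact absurd (List.mem_append_right s₁ (by simp; omega)) h2
  | @bump w l₁ l₂ r₂ s₁ s₂ x y₀ h h1 h2 h3 ih =>
    obtain ⟨-, -, a1, a2, -⟩ := pairwise_split h.isPair.sr₁
    intro i a b ha hb
    have hlt := (List.getElem?_eq_some_iff.1 hb).1
    simp only [List.length_append, List.length_singleton] at hlt
    rw [List.getElem?_append_left (by omega)] at ha
    rcases Nat.lt_or_ge (i + 1) w.length with hi | hi
    · rw [List.getElem?_append_left hi] at hb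
      exact ih i a b ha hb
    · have hi : i + 1 = w.length := by omega
      obtain rfl : x = b := by simpa [hi] using hb
      have hnot : i + 2 ∉ s₁ := fun h5 => by
        have := (h.isPair.mem_iff _).1 (Or.inl h5)
        omega
      rcases List.eq_nil_or_concat w with rfl | ⟨w, u, rfl⟩
      · simp at hi
      rw [List.concat_eq_append] at *
      have hiw : i = w.length := by simpa using hi
      obtain rfl : u = a := by simpa [hiw] using ha
      obtain ⟨q1, q2⟩ := h.last_letter
      rw [hiw] at hnot ⊢
      rcases q2 with ⟨q2, q3⟩ | ⟨q2, z, hz, q3⟩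
      · have := q3 y₀ (by simp)
        exact ⟨fun _ => ⟨q2, hnot⟩, fun _ => by omega⟩
      · refine ⟨fun hxu => ?_, fun h' => absurd h'.1 q2⟩
        exfalso
        have := h3 z hz
        simp only [List.mem_append, List.mem_cons] at q1
        rcases q1 with q1 | rfl | q1
        · have := h1 u q1; omega
        · omega
        · have := a2 u q1; omega

/-! ### The correspondence between `T n` and pairs of ballot sequences -/

theorem length_word {n : ℕ} (π : Equiv.Perm (Fin n)) : (word π).length = n := by simp [word]

theorem getElem?_word {n : ℕ} (π : Equiv.Perm (Fin n)) {i : ℕ} (h : i < n) :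
    (word π)[i]? = some ((π ⟨i, h⟩).val + 1) := by simp [word, h]

theorem nodup_word {n : ℕ} (π : Equiv.Perm (Fin n)) : (word π).Nodup := by
  rw [word, List.nodup_ofFn]
  intro i j h
  exact π.injective (Fin.ext (by simpa using h))

theorem word_injective {n : ℕ} {π σ : Equiv.Perm (Fin n)} (h : word π = word σ) : π = σ := by
  ext i
  have h1 := getElem?_word π i.2
  rw [h, getElem?_word σ i.2] at h1
  simpa using h1.symm

theorem mem_word {n : ℕ} (π : Equiv.Perm (Fin n)) (i : ℕ) : i ∈ word π ↔ 1 ≤ i ∧ i ≤ n := by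
  rw [word, List.mem_ofFn]
  constructor
  · rintro ⟨j, rfl⟩
    have := (π j).2
    omega
  · rintro ⟨h1, h2⟩
    exact ⟨π.symm ⟨i - 1, by omega⟩, by simp; omega⟩

theorem perm_word {n : ℕ} (π : Equiv.Perm (Fin n)) : (word π).Perm (List.range' 1 n) := by
  rw [List.perm_ext_iff_of_nodup (nodup_word π) List.nodup_range']
  intro a
  rw [mem_word, List.mem_range'_1]; omega

theorem exists_word_eq {n : ℕ} {w : List ℕ} (h : w.Perm (List.range' 1 n)) :
    ∃ π : Equiv.Perm (Fin n), word π = w := by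
  have hl : w.length = n := by simpa using h.length_eq
  have hm : ∀ i (hi : i < w.length), 1 ≤ w[i] ∧ w[i] ≤ n := by
    intro i hi
    have := h.mem_iff.1 (List.getElem_mem hi)
    rw [List.mem_range'_1] at this; omega
  have hnd : w.Nodup := h.nodup_iff.2 List.nodup_range'
  let g : Fin n → Fin n := fun i => ⟨w[i.1]'(by rw [hl]; exact i.2) - 1, by
    have := hm i.1 (by rw [hl]; exact i.2)
    have := i.2
    omega⟩
  have hg : Function.Injective g := by
    intro i j hij
    have h1 := hm i.1 (by rw [hl]; exact i.2)
    have h2 := hm j.1 (by rw [hl]; exact j.2)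
    have h3 : w[i.1]'(by rw [hl]; exact i.2) = w[j.1]'(by rw [hl]; exact j.2) := by
      have := congrArg Fin.val hij
      simp only [g] at this
      omega
    exact Fin.ext ((hnd.getElem_inj_iff).1 h3)
  refine ⟨Equiv.ofBijective g (Finite.injective_iff_bijective.1 hg), ?_⟩
  refine List.ext_getElem (by simp [word, hl]) fun i h1 h2 => ?_
  have := hm i h2
  simp [word, g]
  omega

theorem ofFn_comp_sublist {n m : ℕ} (g : Fin n → ℕ) (e : Fin m ↪o Fin n) :
    (List.ofFn (g ∘ e)).Sublist (List.ofFn g) := by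
  rw [List.sublist_iff_exists_fin_orderEmbedding_get_eq]
  refine ⟨((Fin.castOrderIso (by simp)).toOrderEmbedding.trans e).trans
    (Fin.castOrderIso (by simp)).toOrderEmbedding, fun i => ?_⟩
  simp
  rfl

theorem exists_of_sublist_ofFn {n : ℕ} {g : Fin n → ℕ} {l : List ℕ}
    (h : l.Sublist (List.ofFn g)) : ∃ e : Fin l.length ↪o Fin n, ∀ i, l.get i = g (e i) := by
  obtain ⟨e, he⟩ := List.sublist_iff_exists_fin_orderEmbedding_get_eq.1 h
  refine ⟨e.trans (Fin.castOrderIso (by simp)).toOrderEmbedding, fun i => ?_⟩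
  rw [he i]
  simp
  rfl

theorem wordAvoids_word_iff {n : ℕ} (π : Equiv.Perm (Fin n)) :
    WordAvoids (word π) ↔ Avoids321 π := by
  constructor
  · rintro h ⟨i, j, k, hij, hjk, h1, h2⟩
    let e : Fin 3 ↪o Fin n := OrderEmbedding.ofStrictMono ![i, j, k] (by
      rw [Fin.strictMono_iff_lt_succ]
      intro a; fin_cases a <;> simp [hij, hjk])
    have := ofFn_comp_sublist (fun i => (π i).val + 1) e
    simp [e, List.ofFn_succ] at this
    exact h _ _ _ this (by simpa using h2) (by simpa using h1)
  · intro h a b c hs hba hcb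
    obtain ⟨e, he⟩ := exists_of_sublist_ofFn hs
    have h0 := he ⟨0, by simp⟩
    have h1 := he ⟨1, by simp⟩
    have h2 := he ⟨2, by simp⟩
    simp at h0 h1 h2
    refine h ⟨e 0, e 1, e 2, e.lt_iff_lt.2 (by simp), e.lt_iff_lt.2 ?_, ?_, ?_⟩
    · exact Fin.mk_lt_mk.2 (by norm_num)
    · rw [Fin.lt_def]; omega
    · rw [Fin.lt_def]; omega

theorem Run.lis_eq {n : ℕ} {π : Equiv.Perm (Fin n)} {r₁ r₂ s₁ s₂ : List ℕ}
    (h : Run (word π) r₁ r₂ s₁ s₂) : lis π = r₁.length := by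
  apply le_antisymm
  · refine Finset.sup_le fun s hs => ?_
    simp only [Finset.mem_filter, Finset.mem_univ, true_and] at hs
    let e : Fin s.card ↪o Fin n := s.orderEmbOfFin rfl
    have h1 := ofFn_comp_sublist (fun i => (π i).val + 1) e
    have h2 : (List.ofFn ((fun i => (π i).val + 1) ∘ e)).Pairwise (· < ·) := by
      rw [List.pairwise_ofFn]
      intro i j hij
      have := hs (e i) (s.orderEmbOfFin_mem rfl i) (e j) (s.orderEmbOfFin_mem rfl j)
        (e.lt_iff_lt.2 hij)
      simpa using this
    have h3 : (List.ofFn ((fun i => (π i).val + 1) ∘ e)).length = s.card := by simp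
    generalize List.ofFn ((fun i => (π i).val + 1) ∘ e) = l at h1 h2 h3
    rw [← h3]
    rcases List.eq_nil_or_concat l with rfl | ⟨l, z, rfl⟩
    · simp
    · rw [List.concat_eq_append] at *
      obtain ⟨u, hu, -⟩ := h.increasing_bound l z h1 h2
      have := (List.getElem?_eq_some_iff.1 hu).1
      simp; omega
  · rcases List.eq_nil_or_concat r₁ with rfl | ⟨l, z, rfl⟩
    · simp
    · rw [List.concat_eq_append] at *
      obtain ⟨s, h1, h2, h3⟩ := h.exists_increasing l.length z (by simp)
      obtain ⟨e, he⟩ := exists_of_sublist_ofFn h1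
      have hc : (Finset.univ.map e.toEmbedding).card = (l ++ [z]).length := by simp [h3]
      rw [← hc]
      refine Finset.le_sup (f := Finset.card) ?_
      simp only [Finset.mem_filter, Finset.mem_univ, true_and, Finset.mem_map,
        RelEmbedding.coe_toEmbedding]
      rintro _ ⟨i, rfl⟩ _ ⟨j, rfl⟩ hij
      have hij' := e.lt_iff_lt.1 hij
      have := List.pairwise_iff_get.1 h2 i j hij'
      rw [he i, he j] at this
      rw [Fin.lt_def]; omega

theorem tabSeq_twoRows (n : ℕ) (r₁ r₂ : List ℕ) (i : ℕ) :
    tabSeq n (twoRows r₁ r₂) i = if 1 ≤ i ∧ i ≤ n then (if i ∈ r₁ then 1 else -1) else 0 := by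
  simp only [tabSeq, headD_twoRows, Finset.mem_Icc]

theorem countP_le_succ (r : List ℕ) (j : ℕ) :
    r.countP (· ≤ j + 1) = r.countP (· ≤ j) + r.count (j + 1) := by
  induction r with
  | nil => simp
  | cons a r ih =>
    simp only [List.countP_cons, List.count_cons, ih]
    by_cases h1 : a ≤ j
    · simp [h1, h1.trans (Nat.le_succ j), show a ≠ j + 1 by omega]; omega
    · by_cases h2 : a = j + 1
      · simp [h2]; omega
      · simp [h1, h2, show ¬ a ≤ j + 1 by omega]

/-- The sequence `c` and the pair of rows `r₁`, `r₂` describe the same set partition. -/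
structure Matches (n : ℕ) (c : ℕ → ℤ) (r₁ r₂ : List ℕ) : Prop where
  mem₁ : ∀ i, i ∈ r₁ ↔ (1 ≤ i ∧ i ≤ n) ∧ c i = 1
  mem₂ : ∀ i, i ∈ r₂ ↔ (1 ≤ i ∧ i ≤ n) ∧ c i = -1
  pm : ∀ i, 1 ≤ i → i ≤ n → c i = 1 ∨ c i = -1
  zero : ∀ i, ¬ (1 ≤ i ∧ i ≤ n) → c i = 0

theorem Matches.sum_eq {n : ℕ} {c : ℕ → ℤ} {r₁ r₂ : List ℕ} (h : Matches n c r₁ r₂)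
    (h1 : r₁.Nodup) (h2 : r₂.Nodup) : ∀ j ≤ n,
    ∑ i ∈ Finset.Icc 1 j, c i = (r₁.countP (· ≤ j) : ℤ) - r₂.countP (· ≤ j) := by
  intro j
  induction j with
  | zero =>
    intro _
    rw [countP_le_eq_zero (fun z hz => ((h.mem₁ z).1 hz).1.1),
      countP_le_eq_zero (fun z hz => ((h.mem₂ z).1 hz).1.1)]
    simp
  | succ j ih =>
    intro hj
    rw [Finset.sum_Icc_succ_top (by omega), ih (by omega), countP_le_succ, countP_le_succ,
      h1.count, h2.count, if_congr (h.mem₁ _) rfl rfl, if_congr (h.mem₂ _) rfl rfl]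
    rcases h.pm (j + 1) (by omega) hj with h3 | h3 <;> simp [h3, hj] <;> ring

theorem Matches.isBallot {n : ℕ} {c : ℕ → ℤ} {r₁ r₂ : List ℕ} (h : Matches n c r₁ r₂)
    (h1 : r₁.Nodup) (h2 : r₂.Nodup) (hd : Dominates r₁ r₂) : IsBallot n c := by
  refine ⟨fun i hi => ?_, fun i hi => ?_, fun j hj => ?_⟩
  · rw [Finset.mem_Icc] at hi; exact h.pm i hi.1 hi.2
  · rw [Finset.mem_Icc] at hi; exact h.zero i hi
  · rw [h.sum_eq h1 h2 j hj]
    have := hd j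
    omega

theorem Matches.dominates {n : ℕ} {c : ℕ → ℤ} {r₁ r₂ : List ℕ} (h : Matches n c r₁ r₂)
    (h1 : r₁.Nodup) (h2 : r₂.Nodup) (hc : IsBallot n c) : Dominates r₁ r₂ := by
  intro m
  have h3 := hc.2.2 (min m n) (min_le_right _ _)
  rw [h.sum_eq h1 h2 _ (min_le_right _ _)] at h3
  have e : ∀ l : List ℕ, (∀ z ∈ l, z ≤ n) → l.countP (· ≤ min m n) = l.countP (· ≤ m) := by
    intro l hl
    refine List.countP_congr fun z hz => ?_
    have := hl z hz; simp; omega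
  rw [e r₁ (fun z hz => ((h.mem₁ z).1 hz).1.2), e r₂ (fun z hz => ((h.mem₂ z).1 hz).1.2)] at h3
  omega

theorem Matches.numOnes_eq {n : ℕ} {c : ℕ → ℤ} {r₁ r₂ : List ℕ} (h : Matches n c r₁ r₂)
    (h1 : r₁.Nodup) : numOnes n c = r₁.length := by
  rw [numOnes, ← List.toFinset_card_of_nodup h1]
  congr 1
  ext i
  simp [h.mem₁]

theorem Matches.length_add {n : ℕ} {c : ℕ → ℤ} {r₁ r₂ : List ℕ} (h : Matches n c r₁ r₂)
    (h1 : r₁.Nodup) (h2 : r₂.Nodup) : (r₁ ++ r₂).Perm (List.range' 1 n) := by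
  have hnd : (r₁ ++ r₂).Nodup := by
    rw [List.nodup_append]
    refine ⟨h1, h2, ?_⟩
    rintro a ha _ hb rfl
    rw [h.mem₁] at ha; rw [h.mem₂] at hb
    rw [ha.2] at hb; norm_num at hb
  rw [List.perm_ext_iff_of_nodup hnd List.nodup_range']
  intro a
  rw [List.mem_append, h.mem₁, h.mem₂, List.mem_range'_1]
  constructor
  · rintro (h | h) <;> omega
  · intro ha
    rcases h.pm a (by omega) (by omega) with h | h
    · left; exact ⟨by omega, h⟩
    · right; exact ⟨by omega, h⟩

theorem matches_tabSeq {n : ℕ} {r₁ r₂ : List ℕ} (h : (r₁ ++ r₂).Perm (List.range' 1 n)) :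
    Matches n (tabSeq n (twoRows r₁ r₂)) r₁ r₂ := by
  have hnd : (r₁ ++ r₂).Nodup := h.nodup_iff.2 List.nodup_range'
  have hm : ∀ i, (i ∈ r₁ ∨ i ∈ r₂) ↔ 1 ≤ i ∧ i ≤ n := fun i => by
    rw [← List.mem_append, h.mem_iff, List.mem_range'_1]; omega
  have hdis : ∀ i, i ∈ r₁ → i ∈ r₂ → False := fun i h1 h2 => by
    rw [List.nodup_append] at hnd; exact hnd.2.2 i h1 i h2 rfl
  refine ⟨fun i => ?_, fun i => ?_, fun i h1 h2 => ?_, fun i hi => ?_⟩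
  · simp only [tabSeq_twoRows, ← hm]
    by_cases h1 : i ∈ r₁
    · simp [h1]
    · by_cases h2 : i ∈ r₂ <;> simp [h1, h2]
  · simp only [tabSeq_twoRows, ← hm]
    by_cases h1 : i ∈ r₁
    · simpa [h1] using fun h2 => hdis i h1 h2
    · simp [h1]
  · rw [tabSeq_twoRows, if_pos ⟨h1, h2⟩]; split_ifs <;> simp
  · rw [tabSeq_twoRows, if_neg hi]

theorem exists_run_word {n : ℕ} (π : T n) : ∃ r₁ r₂ s₁ s₂, Run (word π.1) r₁ r₂ s₁ s₂ :=
  exists_run (nodup_word _) ((wordAvoids_word_iff _).2 π.2)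

theorem Run.matches_pSeq {n : ℕ} {π : T n} {r₁ r₂ s₁ s₂ : List ℕ}
    (h : Run (word π.1) r₁ r₂ s₁ s₂) : Matches n (pSeq π) r₁ r₂ := by
  rw [pSeq, h.rsk_eq]
  exact matches_tabSeq (h.perm.symm.trans (perm_word _))

theorem Run.matches_qSeq {n : ℕ} {π : T n} {r₁ r₂ s₁ s₂ : List ℕ}
    (h : Run (word π.1) r₁ r₂ s₁ s₂) : Matches n (qSeq π) s₁ s₂ := by
  rw [qSeq, h.rsk_eq]
  have := h.isPair.perm
  rw [length_word] at this
  exact matches_tabSeq this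

theorem pairwise_lt_nodup {r : List ℕ} (h : r.Pairwise (· < ·)) : r.Nodup :=
  h.imp (fun h => ne_of_lt h)

theorem isBallot_pSeq {n : ℕ} (π : T n) : IsBallot n (pSeq π) := by
  obtain ⟨r₁, r₂, s₁, s₂, h⟩ := exists_run_word π
  exact h.matches_pSeq.isBallot (pairwise_lt_nodup h.isPair.sr₁) (pairwise_lt_nodup h.isPair.sr₂)
    h.isPair.dr

theorem isBallot_qSeq {n : ℕ} (π : T n) : IsBallot n (qSeq π) := by
  obtain ⟨r₁, r₂, s₁, s₂, h⟩ := exists_run_word π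
  exact h.matches_qSeq.isBallot (pairwise_lt_nodup h.isPair.ss₁) (pairwise_lt_nodup h.isPair.ss₂)
    h.isPair.ds

theorem numOnes_pSeq {n : ℕ} (π : T n) : numOnes n (pSeq π) = lis π.1 := by
  obtain ⟨r₁, r₂, s₁, s₂, h⟩ := exists_run_word π
  rw [h.matches_pSeq.numOnes_eq (pairwise_lt_nodup h.isPair.sr₁), h.lis_eq]

theorem numOnes_qSeq {n : ℕ} (π : T n) : numOnes n (qSeq π) = lis π.1 := by
  obtain ⟨r₁, r₂, s₁, s₂, h⟩ := exists_run_word π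
  rw [h.matches_qSeq.numOnes_eq (pairwise_lt_nodup h.isPair.ss₁), h.lis_eq, h.isPair.len₁]

theorem ldes_eq_del {n : ℕ} (π : T n) : ldes π.1 = del n (qSeq π) := by
  obtain ⟨r₁, r₂, s₁, s₂, h⟩ := exists_run_word π
  have hq := h.matches_qSeq
  have key : ∀ i (hi : i + 1 < n), (π.1 ⟨i + 1, hi⟩ < π.1 ⟨i, by omega⟩ ↔
      qSeq π (i + 1) = 1 ∧ qSeq π (i + 2) = -1) := by
    intro i hi
    have h1 := h.descent_iff i _ _ (getElem?_word π.1 (by omega)) (getElem?_word π.1 hi)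
    rw [hq.mem₁, hq.mem₁] at h1
    rw [Fin.lt_def]
    have : (1 ≤ i + 2 ∧ i + 2 ≤ n) := by omega
    have : (1 ≤ i + 1 ∧ i + 1 ≤ n) := by omega
    rcases hq.pm (i + 2) (by omega) (by omega) with h3 | h3 <;> simp_all
  unfold ldes del greatestOrZero
  apply le_antisymm
  · refine Finset.sup_le fun i hi => ?_
    simp only [Finset.mem_filter, Finset.mem_univ, true_and] at hi
    obtain ⟨hi, h1⟩ := hi
    refine Finset.le_sup (f := id) (b := i.val + 1) ?_
    have := (key i.val hi).1 h1
    simp only [Finset.mem_filter, Finset.mem_Ico]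
    exact ⟨⟨by omega, hi⟩, this⟩
  · refine Finset.sup_le fun i hi => ?_
    simp only [Finset.mem_filter, Finset.mem_Ico] at hi
    obtain ⟨j, rfl⟩ : ∃ j, i = j + 1 := ⟨i - 1, by omega⟩
    have h2 := (key j hi.1.2).2 hi.2
    refine Finset.le_sup (f := fun i : Fin n => i.val + 1) (b := ⟨j, by omega⟩) ?_
    simp only [Finset.mem_filter, Finset.mem_univ, true_and]
    exact ⟨hi.1.2, h2⟩

/-! ### The pair `(p, q)` determines the permutation, and every admissible pair occurs. -/

theorem eq_of_mem_iff {r r' : List ℕ} (h : r.Pairwise (· < ·)) (h' : r'.Pairwise (· < ·))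
    (hm : ∀ i, i ∈ r ↔ i ∈ r') : r = r' := by
  have := (List.perm_ext_iff_of_nodup (pairwise_lt_nodup h) (pairwise_lt_nodup h')).2 hm
  exact this.eq_of_pairwise (fun a b _ _ h1 h2 => absurd h1 (lt_asymm h2)) h h'

theorem eq_of_pSeq_eq_of_qSeq_eq {n : ℕ} {π σ : T n} (hp : pSeq π = pSeq σ)
    (hq : qSeq π = qSeq σ) : π = σ := by
  obtain ⟨r₁, r₂, s₁, s₂, h⟩ := exists_run_word π
  obtain ⟨r₁', r₂', s₁', s₂', h'⟩ := exists_run_word σ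
  have mp := h.matches_pSeq; have mq := h.matches_qSeq
  have mp' := h'.matches_pSeq; have mq' := h'.matches_qSeq
  rw [← hp] at mp'; rw [← hq] at mq'
  obtain rfl := eq_of_mem_iff h.isPair.sr₁ h'.isPair.sr₁ (fun i => by rw [mp.mem₁, mp'.mem₁])
  obtain rfl := eq_of_mem_iff h.isPair.sr₂ h'.isPair.sr₂ (fun i => by rw [mp.mem₂, mp'.mem₂])
  obtain rfl := eq_of_mem_iff h.isPair.ss₁ h'.isPair.ss₁ (fun i => by rw [mq.mem₁, mq'.mem₁])
  obtain rfl := eq_of_mem_iff h.isPair.ss₂ h'.isPair.ss₂ (fun i => by rw [mq.mem₂, mq'.mem₂])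
  exact Subtype.ext (word_injective (h.unique h'))

theorem IsBallot.exists_matches {n : ℕ} {c : ℕ → ℤ} (h : IsBallot n c) :
    ∃ r₁ r₂ : List ℕ, Matches n c r₁ r₂ ∧ r₁.Pairwise (· < ·) ∧ r₂.Pairwise (· < ·) := by
  have hs : (List.range' 1 n).Pairwise (· < ·) := List.pairwise_lt_range'
  refine ⟨(List.range' 1 n).filter (fun i => c i = 1), (List.range' 1 n).filter (fun i => c i = -1),
    ⟨fun i => ?_, fun i => ?_, fun i h1 h2 => h.1 i (Finset.mem_Icc.2 ⟨h1, h2⟩),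
      fun i hi => h.2.1 i (by rwa [Finset.mem_Icc])⟩, hs.filter _, hs.filter _⟩
  · simp [List.mem_range'_1]; intro _; omega
  · simp [List.mem_range'_1]; intro _; omega

theorem tabSeq_eq_of_matches {n : ℕ} {c : ℕ → ℤ} {r₁ r₂ : List ℕ} (h : Matches n c r₁ r₂) :
    tabSeq n (twoRows r₁ r₂) = c := by
  funext i
  rw [tabSeq_twoRows]
  by_cases hi : 1 ≤ i ∧ i ≤ n
  · rcases h.pm i hi.1 hi.2 with h1 | h1 <;> simp [hi, h.mem₁, h1]
  · rw [if_neg hi, h.zero i hi]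

theorem exists_pSeq_qSeq_eq {n : ℕ} {p q : ℕ → ℤ} (hp : IsBallot n p) (hq : IsBallot n q)
    (hpq : numOnes n p = numOnes n q) : ∃ π : T n, pSeq π = p ∧ qSeq π = q := by
  obtain ⟨r₁, r₂, mp, a1, a2⟩ := hp.exists_matches
  obtain ⟨s₁, s₂, mq, b1, b2⟩ := hq.exists_matches
  have c1 := pairwise_lt_nodup a1; have c2 := pairwise_lt_nodup a2
  have d1 := pairwise_lt_nodup b1; have d2 := pairwise_lt_nodup b2
  have pp := mp.length_add c1 c2; have pq := mq.length_add d1 d2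
  have lp := pp.length_eq; have lq := pq.length_eq
  rw [mp.numOnes_eq c1, mq.numOnes_eq d1] at hpq
  simp only [List.length_append, List.length_range'] at lp lq
  have hpair : IsPair n r₁ r₂ s₁ s₂ := ⟨lp, hpq.symm, by omega, a1, a2, b1, b2, pq,
    mp.dominates c1 c2 hp, mq.dominates d1 d2 hq⟩
  obtain ⟨w, hw⟩ := exists_run_of_isPair hpair (pp.nodup_iff.2 List.nodup_range')
  obtain ⟨π, rfl⟩ := exists_word_eq (hw.perm.trans pp)
  refine ⟨⟨π, (wordAvoids_word_iff π).1 hw.wordAvoids⟩, ?_, ?_⟩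
  · change tabSeq n (rsk (word π)).1 = p
    rw [hw.rsk_eq, tabSeq_eq_of_matches mp]
  · change tabSeq n (rsk (word π)).2 = q
    rw [hw.rsk_eq, tabSeq_eq_of_matches mq]

/-! ### Partial sums of ballot sequences -/

/-- The partial sum `c_1 + ⋯ + c_j`. -/
def height (c : ℕ → ℤ) (j : ℕ) : ℤ := ∑ i ∈ Finset.Icc 1 j, c i

theorem height_zero (c : ℕ → ℤ) : height c 0 = 0 := by simp [height]

theorem height_succ (c : ℕ → ℤ) (j : ℕ) : height c (j + 1) = height c j + c (j + 1) := by
  rw [height, Finset.sum_Icc_succ_top (by omega)]; rfl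

theorem numOnes_zero (c : ℕ → ℤ) : numOnes 0 c = 0 := by simp [numOnes]

theorem numOnes_succ (c : ℕ → ℤ) (j : ℕ) :
    numOnes (j + 1) c = numOnes j c + if c (j + 1) = 1 then 1 else 0 := by
  unfold numOnes
  rw [← Finset.insert_Icc_right_eq_Icc_add_one (by omega), Finset.filter_insert]
  split_ifs with h
  · rw [Finset.card_insert_of_notMem (by simp)]
  · rfl

theorem height_congr {c c' : ℕ → ℤ} {j : ℕ} (h : ∀ i ≤ j, c i = c' i) : height c j = height c' j :=
  Finset.sum_congr rfl fun i hi => h i (Finset.mem_Icc.1 hi).2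

theorem numOnes_congr {c c' : ℕ → ℤ} {j : ℕ} (h : ∀ i ≤ j, c i = c' i) :
    numOnes j c = numOnes j c' := by
  unfold numOnes
  congr 1
  exact Finset.filter_congr fun i hi => by rw [h i (Finset.mem_Icc.1 hi).2]

theorem IsBallot.pm {n : ℕ} {c : ℕ → ℤ} (h : IsBallot n c) {i : ℕ} (h1 : 1 ≤ i) (h2 : i ≤ n) :
    c i = 1 ∨ c i = -1 := h.1 i (Finset.mem_Icc.2 ⟨h1, h2⟩)

theorem IsBallot.height_nonneg {n : ℕ} {c : ℕ → ℤ} (h : IsBallot n c) {j : ℕ} (hj : j ≤ n) :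
    0 ≤ height c j := h.2.2 j hj

theorem IsBallot.eq_zero {n : ℕ} {c : ℕ → ℤ} (h : IsBallot n c) {i : ℕ}
    (hi : ¬ (1 ≤ i ∧ i ≤ n)) : c i = 0 := h.2.1 i (by rwa [Finset.mem_Icc])

theorem isBallot_of {n : ℕ} {c : ℕ → ℤ} (h1 : ∀ i, 1 ≤ i → i ≤ n → c i = 1 ∨ c i = -1)
    (h2 : ∀ i, ¬ (1 ≤ i ∧ i ≤ n) → c i = 0) (h3 : ∀ j ≤ n, 0 ≤ height c j) : IsBallot n c :=
  ⟨fun i hi => h1 i (Finset.mem_Icc.1 hi).1 (Finset.mem_Icc.1 hi).2,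
    fun i hi => h2 i (by rwa [Finset.mem_Icc] at hi), h3⟩

theorem height_eq_of_pm {n : ℕ} {c : ℕ → ℤ} (h : ∀ i, 1 ≤ i → i ≤ n → c i = 1 ∨ c i = -1) :
    ∀ j ≤ n, height c j = 2 * numOnes j c - j := by
  intro j
  induction j with
  | zero => simp [height_zero, numOnes_zero]
  | succ j ih =>
    intro hj
    rw [height_succ, numOnes_succ, ih (by omega)]
    rcases h (j + 1) (by omega) hj with h | h <;> simp [h] <;> ring

theorem IsBallot.height_eq {n : ℕ} {c : ℕ → ℤ} (h : IsBallot n c) {j : ℕ} (hj : j ≤ n) :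
    height c j = 2 * numOnes j c - j := height_eq_of_pm (fun _ h1 h2 => h.pm h1 h2) j hj

theorem numOnes_le (n : ℕ) (c : ℕ → ℤ) : numOnes n c ≤ n := by
  have := Finset.card_filter_le (Finset.Icc 1 n) (fun i => c i = 1)
  simpa [numOnes] using this

theorem IsBallot.first {n : ℕ} {c : ℕ → ℤ} (h : IsBallot n c) (hn : 1 ≤ n) : c 1 = 1 := by
  have h1 := h.height_nonneg hn
  rw [show (1 : ℕ) = 0 + 1 from rfl, height_succ, height_zero] at h1
  rcases h.pm le_rfl hn with h2 | h2
  · exact h2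
  · rw [zero_add, h2] at h1; norm_num at h1

theorem exchange_apply (c : ℕ → ℤ) (i j m : ℕ) :
    exchange c i j m = if m = i then c j else if m = j then c i else c m := by
  unfold exchange
  rw [Equiv.swap_apply_def]
  split_ifs <;> rfl

theorem height_exchange (c : ℕ → ℤ) {i j : ℕ} (hi : 1 ≤ i) (hij : i < j) (m : ℕ) :
    height (exchange c i j) m = height c m + if i ≤ m ∧ m < j then c j - c i else 0 := by
  induction m with
  | zero => simp [height_zero]; intro h; omega
  | succ m ih =>
    rw [height_succ, height_succ, ih, exchange_apply]
    by_cases h1 : m + 1 = i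
    · simp [h1, show ¬ i ≤ m by omega, hij]
    · by_cases h2 : m + 1 = j
      · have h3 : i ≤ m ∧ m < j := by omega
        simp [h3, h2, hij.ne']; ring
      · have h3 : (i ≤ m ∧ m < j) ↔ (i ≤ m + 1 ∧ m + 1 < j) := by omega
        simp only [h1, h2, h3, if_false]; ring

/-- A swap changes only the partial sums at positions in `[i, j)`, all by `c j - c i`. The total is
unchanged, and with it the number of ones. -/
theorem IsBallot.exchange {n : ℕ} {c : ℕ → ℤ} (h : IsBallot n c) {i j : ℕ} (hi : 1 ≤ i)
    (hij : i < j) (hj : j ≤ n) (hc : ∀ m, i ≤ m → m < j → 0 ≤ height c m + (c j - c i)) :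
    IsBallot n (exchange c i j) ∧ numOnes n (SignBalance.exchange c i j) = numOnes n c := by
  have hpm : ∀ m, 1 ≤ m → m ≤ n →
      SignBalance.exchange c i j m = 1 ∨ SignBalance.exchange c i j m = -1 := by
    intro m h1 h2
    rw [exchange_apply]
    split_ifs
    · exact h.pm (by omega) hj
    · exact h.pm hi (by omega)
    · exact h.pm h1 h2
  refine ⟨isBallot_of hpm ?_ ?_, ?_⟩
  · intro m hm
    rw [exchange_apply, if_neg (by omega), if_neg (by omega), h.eq_zero hm]
  · intro m hm
    rw [height_exchange c hi hij]
    split_ifs with h1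
    · exact hc m h1.1 h1.2
    · simpa using h.height_nonneg hm
  · have h1 := height_eq_of_pm hpm n le_rfl
    have h2 := h.height_eq le_rfl
    rw [height_exchange c hi hij, if_neg (by omega)] at h1
    omega

theorem exchange_ne {c : ℕ → ℤ} {i j : ℕ} (h : c i ≠ c j) : exchange c i j ≠ c := by
  intro h1
  have := congrFun h1 i
  rw [exchange_apply, if_pos rfl] at this
  exact h this.symm

/-! ### The statistics `ε` and `δ` -/

theorem eps_spec (n : ℕ) (c : ℕ → ℤ) :
    (eps n c = 0 ∧ ∀ i, 1 ≤ i → i < n → Even i → c i ≠ - c (i + 1)) ∨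
    (1 ≤ eps n c ∧ eps n c < n ∧ Even (eps n c) ∧ c (eps n c) = - c (eps n c + 1) ∧
      ∀ i, 1 ≤ i → i < eps n c → Even i → c i ≠ - c (i + 1)) := by
  unfold eps leastOrZero
  split_ifs with h
  · right
    have h1 := Finset.min'_mem _ h
    simp only [Finset.mem_filter, Finset.mem_Ico] at h1
    refine ⟨h1.1.1, h1.1.2, h1.2.1, h1.2.2, ?_⟩
    intro i hi hlt he hc
    have := Finset.min'_le ((Finset.Ico 1 n).filter (fun i => Even i ∧ c i = - c (i + 1))) i
      (Finset.mem_filter.2 ⟨Finset.mem_Ico.2 ⟨hi, hlt.trans h1.1.2⟩, he, hc⟩)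
    omega
  · left
    refine ⟨rfl, fun i h1 h2 h3 h4 => h ⟨i, ?_⟩⟩
    simp only [Finset.mem_filter, Finset.mem_Ico]
    exact ⟨⟨h1, h2⟩, h3, h4⟩

/-- The terms in positions `2i` and `2i + 1` agree, whenever `2i + 1 ≤ n`. -/
def PairEq (n : ℕ) (c : ℕ → ℤ) : Prop := ∀ i, 1 ≤ i → i < n → Even i → c i = c (i + 1)

theorem PairEq.mono {n m : ℕ} {c : ℕ → ℤ} (h : PairEq n c) (hm : m ≤ n) : PairEq m c :=
  fun i h1 h2 h3 => h i h1 (by omega) h3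

theorem IsBallot.ne_neg_iff {n : ℕ} {c : ℕ → ℤ} (h : IsBallot n c) {i : ℕ} (h1 : 1 ≤ i)
    (h2 : i < n) : c i ≠ - c (i + 1) ↔ c i = c (i + 1) := by
  rcases h.pm h1 h2.le with h3 | h3 <;> rcases h.pm (i := i + 1) (by omega) h2 with h4 | h4 <;>
    simp [h3, h4]

/-- The first defect of the pairing is not before position `m`. -/
theorem IsBallot.pairEq_iff {n : ℕ} {c : ℕ → ℤ} (h : IsBallot n c) {m : ℕ} (hm : m ≤ n) :
    PairEq m c ↔ eps n c = 0 ∨ m ≤ eps n c := by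
  rcases eps_spec n c with ⟨h1, h2⟩ | ⟨h1, h2, h3, h4, h5⟩
  · simp only [h1, true_or, iff_true]
    exact fun i a1 a2 a3 => (h.ne_neg_iff a1 (by omega)).1 (h2 i a1 (by omega) a3)
  · constructor
    · intro hp
      right
      by_contra hlt
      have := hp _ h1 (by omega) h3
      exact (h.ne_neg_iff h1 h2).2 this h4
    · rintro (h6 | h6)
      · omega
      · exact fun i a1 a2 a3 => (h.ne_neg_iff a1 (by omega)).1 (h5 i a1 (by omega) a3)

theorem del_spec (n : ℕ) (c : ℕ → ℤ) :
    (del n c = 0 ∨ (1 ≤ del n c ∧ del n c < n ∧ c (del n c) = 1 ∧ c (del n c + 1) = -1)) ∧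
    ∀ i, del n c < i → i < n → ¬ (c i = 1 ∧ c (i + 1) = -1) := by
  unfold del greatestOrZero
  set s := (Finset.Ico 1 n).filter (fun i => c i = 1 ∧ c (i + 1) = -1) with hs
  constructor
  · rcases s.eq_empty_or_nonempty with h | h
    · left; simp [h]
    · right
      obtain ⟨i, hi, h1⟩ := Finset.exists_mem_eq_sup s h id
      rw [h1]
      simp only [hs, Finset.mem_filter, Finset.mem_Ico] at hi
      exact ⟨hi.1.1, hi.1.2, hi.2⟩
  · intro i h1 h2 h3
    have : i ∈ s := by
      simp only [hs, Finset.mem_filter, Finset.mem_Ico]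
      exact ⟨⟨by omega, h2⟩, h3⟩
    have := Finset.le_sup (f := id) this
    simp only [id] at this h1
    omega

theorem del_eq_of {n d : ℕ} {c : ℕ → ℤ} (h1 : 1 ≤ d) (h2 : d < n) (h3 : c d = 1)
    (h4 : c (d + 1) = -1) (h5 : ∀ i, d < i → i < n → ¬ (c i = 1 ∧ c (i + 1) = -1)) :
    del n c = d := by
  obtain ⟨a1, a2⟩ := del_spec n c
  rcases lt_trichotomy (del n c) d with h | h | h
  · exact absurd ⟨h3, h4⟩ (a2 d h h2)
  · exact h
  · rcases a1 with a1 | ⟨-, b1, b2⟩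
    · omega
    · exact absurd b2 (h5 _ h b1)

/-- After the last descent `d` there are `a ≥ 1` terms `-1`, followed by terms `1` only. -/
theorem IsBallot.exists_tail {n d : ℕ} {c : ℕ → ℤ} (h : IsBallot n c) (hd : del n c = d)
    (h0 : 1 ≤ d) : ∃ a, 1 ≤ a ∧ d + a ≤ n ∧ c d = 1 ∧
      (∀ i, d < i → i ≤ d + a → c i = -1) ∧ ∀ i, d + a < i → i ≤ n → c i = 1 := by
  obtain ⟨a1, a2⟩ := del_spec n c
  rw [hd] at a1 a2
  rcases a1 with a1 | ⟨-, b1, b2, b3⟩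
  · omega
  set s := (Finset.Icc 1 n).filter (fun i => c i = -1) with hs
  have hne : s.Nonempty := ⟨d + 1, by simp [hs, b3]; omega⟩
  have hmem := Finset.max'_mem s hne
  have hle := Finset.le_max' s
  set j := s.max' hne
  have hdj : d + 1 ≤ j := hle (d + 1) (by simp [hs, b3]; omega)
  simp only [hs, Finset.mem_filter, Finset.mem_Icc] at hmem
  have hones : ∀ i, d < i → c i = 1 → ∀ t, i + t ≤ n → c (i + t) = 1 := by
    intro i hi hc t
    induction t with
    | zero => intro _; exact hc
    | succ t ih =>
      intro ht
      rcases h.pm (i := i + t + 1) (by omega) (by omega) with h1 | h1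
      · exact h1
      · exact absurd ⟨ih (by omega), h1⟩ (a2 (i + t) (by omega) (by omega))
  refine ⟨j - d, by omega, by omega, b2, fun i h1 h2 => ?_, fun i h1 h2 => ?_⟩
  · rcases h.pm (i := i) (by omega) (by omega) with h3 | h3
    · have := hones i h1 h3 (j - i) (by omega)
      rw [show i + (j - i) = j by omega, hmem.2] at this
      norm_num at this
    · exact h3
  · rcases h.pm (i := i) (by omega) (by omega) with h3 | h3
    · exact h3
    · have := hle i (by simp only [hs, Finset.mem_filter, Finset.mem_Icc]; exact ⟨by omega, h3⟩)
      omega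

theorem height_add_of_const {c : ℕ → ℤ} {d a : ℕ} {v : ℤ}
    (h : ∀ i, d < i → i ≤ d + a → c i = v) : height c (d + a) = height c d + a * v := by
  induction a with
  | zero => simp
  | succ a ih =>
    rw [← add_assoc, height_succ, ih (fun i h1 h2 => h i h1 (by omega)), h (d + a + 1) (by omega) (by omega)]
    push_cast; ring

/-- The first term is 1 and the others come in equal pairs. -/
theorem numOnes_odd {c : ℕ → ℤ} {m : ℕ}
    (h : IsBallot (2 * m + 1) c) (hp : PairEq (2 * m + 1) c) : Odd (numOnes (2 * m + 1) c) := by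
  have key : ∀ j ≤ m, Odd (numOnes (2 * j + 1) c) := by
    intro j
    induction j with
    | zero => simp [numOnes_succ, numOnes_zero, h.first (by omega)]
    | succ j ih =>
      intro hj
      rw [show 2 * (j + 1) + 1 = 2 * j + 1 + 1 + 1 by ring, numOnes_succ, numOnes_succ]
      have h1 := hp (2 * j + 1 + 1) (by omega) (by omega) ⟨j + 1, by ring⟩
      obtain ⟨r, hr⟩ := ih (by omega)
      rw [← h1]
      split_ifs
      · exact ⟨r + 1, by omega⟩
      · exact ⟨r, by omega⟩
  exact key m le_rfl

/-- The initial segment of length `d`. -/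
def trunc (d : ℕ) (c : ℕ → ℤ) : ℕ → ℤ := fun i => if i ≤ d then c i else 0

theorem trunc_apply {d i : ℕ} (c : ℕ → ℤ) (h : i ≤ d) : trunc d c i = c i := if_pos h

theorem IsBallot.trunc {n d : ℕ} {c : ℕ → ℤ} (h : IsBallot n c) (hd : d ≤ n) :
    IsBallot d (trunc d c) := by
  refine isBallot_of ?_ ?_ ?_
  · intro i h1 h2
    rw [trunc_apply c h2]; exact h.pm h1 (h2.trans hd)
  · intro i hi
    unfold SignBalance.trunc
    split_ifs with h1
    · exact h.eq_zero (by omega)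
    · rfl
  · intro j hj
    rw [height_congr (c' := c) (fun i hi => trunc_apply c (hi.trans hj))]
    exact h.height_nonneg (hj.trans hd)

theorem PairEq.trunc {d m : ℕ} {c : ℕ → ℤ} (hm : m ≤ d) : PairEq m (trunc d c) ↔ PairEq m c := by
  refine forall_congr' fun i => forall_congr' fun h1 => forall_congr' fun h2 =>
    forall_congr' fun _ => ?_
  rw [trunc_apply c (by omega), trunc_apply c (by omega)]

theorem IsBallot.numOnes_prefix_odd {n m : ℕ} {c : ℕ → ℤ} (h : IsBallot n c) (hm : 2 * m + 1 ≤ n)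
    (hp : PairEq (2 * m + 1) c) : Odd (numOnes (2 * m + 1) c) := by
  rw [← numOnes_congr (c := SignBalance.trunc (2 * m + 1) c) (fun i hi => trunc_apply c hi)]
  exact numOnes_odd (h.trunc hm) ((PairEq.trunc le_rfl).2 hp)

/-! ### The maps `φ` and `ψ` -/

/-- Only the partial sum at `ε` changes. If it drops, then `c_ε = 1` makes it positive, and it is
even because `ε` is even, so it is at least 2. -/
theorem IsBallot.phi {n : ℕ} {c : ℕ → ℤ} (h : IsBallot n c) (he : 0 < eps n c) :
    IsBallot n (phi n c) ∧ numOnes n (phi n c) = numOnes n c ∧ SignBalance.phi n c ≠ c := by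
  rcases eps_spec n c with ⟨h1, -⟩ | ⟨h1, h2, h3, h4, -⟩
  · omega
  unfold SignBalance.phi
  set e := eps n c
  have hne : c e ≠ c (e + 1) := by
    rcases h.pm h1 h2.le with h5 | h5 <;> rw [h5] at h4 ⊢ <;> intro h6 <;> rw [← h6] at h4 <;>
      norm_num at h4
  obtain ⟨a1, a2⟩ := h.exchange h1 (lt_add_one e) h2 (fun m hm1 hm2 => by
    have hm : m = e := by omega
    rw [hm]
    rcases h.pm h1 h2.le with h5 | h5
    · have h6 := h.height_eq h2.le
      have h7 := h.height_nonneg (j := e - 1) (by omega)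
      have h8 := height_succ c (e - 1)
      rw [Nat.sub_add_cancel h1, h5] at h8
      obtain ⟨r, hr⟩ := h3
      omega
    · have := h.height_nonneg h2.le
      omega)
  exact ⟨a1, a2, exchange_ne hne⟩

theorem leastOrZero_mem {s : Finset ℕ} (h : s.Nonempty) : leastOrZero s ∈ s := by
  rw [leastOrZero, dif_pos h]; exact s.min'_mem h

/-- For `q` in `B**` the swap raises partial sums. For `q` in `A*` it lowers them by 2 from `d - 1`
up to the end of the block of `-1`. That block ends at an odd position, where the partial sum is odd
and hence at least 1, so every affected partial sum is at least 2. -/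
theorem IsBallot.psi {n k d : ℕ} {q : ℕ → ℤ} (h : IsBallot n q) (hk : numOnes n q = k)
    (hd : del n q = d) (hq : q ∈ Astar n k ∪ Bstarstar n k) (he : Even (n - k)) (ho : Odd d) :
    IsBallot n (psi n d q) ∧ numOnes n (psi n d q) = numOnes n q ∧ SignBalance.psi n d q ≠ q := by
  obtain ⟨e, rfl⟩ := ho
  obtain ⟨a, ha1, ha2, hqd, ht1, ht2⟩ := h.exists_tail hd (by omega)
  unfold SignBalance.psi
  rcases hq with ⟨-, -, h0⟩ | ⟨⟨⟨-, -, h0⟩, hB⟩, hlast⟩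
  · rw [if_pos h0]
    have hj : greatestOrZero ((Finset.Icc 1 n).filter (fun i => q i = -1)) = 2 * e + 1 + a := by
      unfold greatestOrZero
      apply le_antisymm
      · refine Finset.sup_le fun i hi => ?_
        simp only [Finset.mem_filter, Finset.mem_Icc] at hi
        by_contra hlt
        have := ht2 i (by simpa using hlt) hi.1.2
        rw [hi.2] at this; norm_num at this
      · refine Finset.le_sup (f := id) (b := 2 * e + 1 + a) ?_
        simp only [Finset.mem_filter, Finset.mem_Icc]
        exact ⟨by omega, ht1 _ (by omega) le_rfl⟩
    rw [hj]
    have hp : PairEq n q := (h.pairEq_iff le_rfl).2 (Or.inl h0)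
    obtain ⟨r, hr⟩ := h.numOnes_prefix_odd (m := e) (by omega) (hp.mono (by omega))
    have g1 := h.height_eq (j := 2 * e + 1) (by omega)
    have g2 := height_add_of_const ht1
    have g3 := h.height_nonneg (j := 2 * e + 1 + a) ha2
    have g4 := height_add_of_const (c := q) (d := 2 * e + 1 + a) (a := n - (2 * e + 1 + a)) (v := 1)
      (fun i h1 h2 => ht2 i h1 (by omega))
    rw [Nat.add_sub_cancel' ha2] at g4
    have g5 := h.height_eq (j := n) le_rfl
    obtain ⟨u, hu⟩ := he
    have hkn := numOnes_le n q
    -- Parity: `d` and the number of ones up to `d` are odd and `n - k` is even, so the block of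
    -- `-1` has even length.
    have hae : ∃ b, a = 2 * b := ⟨u + r - e, by omega⟩
    obtain ⟨b, rfl⟩ := hae
    -- For `d = 1` the partial sum at `d` is at most 1 and cannot absorb a block of at least two
    -- `-1`.
    have he1 : 1 ≤ e := by
      by_contra hcon
      obtain rfl : e = 0 := by omega
      have := numOnes_le (2 * 0 + 1) q
      push_cast at *
      omega
    have hpe : q (2 * e) = q (2 * e + 1) := hp _ (by omega) (by omega) ⟨e, by ring⟩
    have hj1 := ht1 (2 * e + 1 + 2 * b) (by omega) le_rfl
    simp only [Nat.add_sub_cancel]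
    obtain ⟨b1, b2⟩ := h.exchange (i := 2 * e) (j := 2 * e + 1 + 2 * b) (by omega) (by omega) ha2
      (fun m h1 h2 => by
        rw [hj1, hpe, hqd]
        rcases Nat.lt_or_ge m (2 * e + 1) with hm | hm
        · obtain rfl : m = 2 * e := by omega
          have := height_succ q (2 * e)
          rw [hqd] at this
          push_cast at *
          omega
        · obtain ⟨t, rfl⟩ := Nat.exists_eq_add_of_le hm
          rw [height_add_of_const (v := -1) (fun i h1 h2 => ht1 i h1 (by omega))]
          push_cast at *
          omega)
    refine ⟨b1, b2, exchange_ne ?_⟩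
    rw [hj1, hpe, hqd]; norm_num
  · rw [if_neg h0.ne']
    have hne : ((Finset.Icc 1 n).filter (fun i => 2 * e + 1 < i ∧ q i = 1)).Nonempty :=
      ⟨n, by simp only [Finset.mem_filter, Finset.mem_Icc]; exact ⟨by omega, by omega, hlast⟩⟩
    have hm := leastOrZero_mem hne
    set j := leastOrZero ((Finset.Icc 1 n).filter (fun i => 2 * e + 1 < i ∧ q i = 1))
    simp only [Finset.mem_filter, Finset.mem_Icc] at hm
    have hB : eps n q = 2 * e := by omega
    rcases eps_spec n q with ⟨h1, -⟩ | ⟨h1, h2, h3, h4, -⟩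
    · omega
    rw [hB, hqd] at h4
    simp only [Nat.add_sub_cancel]
    obtain ⟨b1, b2⟩ := h.exchange (i := 2 * e) (j := j) (by omega) (by omega) (by omega)
      (fun m h1 h2 => by
        rw [h4, hm.2.2]
        have := h.height_nonneg (j := m) (by omega)
        omega)
    refine ⟨b1, b2, exchange_ne ?_⟩
    rw [h4, hm.2.2]; norm_num

/-! ### The map `Ψ` and its fixed points -/

theorem pSeq_mem_A_or {n : ℕ} (π : T n) : pSeq π ∈ A n (lis π.1) ∨ pSeq π ∈ Astar n (lis π.1) := by
  rcases Nat.eq_zero_or_pos (eps n (pSeq π)) with h | h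
  · exact Or.inr ⟨isBallot_pSeq π, numOnes_pSeq π, h⟩
  · exact Or.inl ⟨isBallot_pSeq π, numOnes_pSeq π, h⟩

/-- The sequences `q` with `k` ones and last descent `d` that are left unchanged. -/
def FixedSeq (n k d : ℕ) : Set (ℕ → ℤ) :=
  {q | IsBallot n q ∧ numOnes n q = k ∧ del n q = d ∧ q ∉ B n k ∧
    ¬ (q ∈ Astar n k ∪ Bstarstar n k ∧ Even (n - k) ∧ Odd d)}

/-- In every branch but the last, one of the sequences is altered by a swap of unequal terms, so the
pair is unchanged exactly in the last branch. -/
theorem psiPair_spec {n : ℕ} (π : T n) :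
    (IsBallot n (psiPair π).1 ∧ IsBallot n (psiPair π).2 ∧
      numOnes n (psiPair π).1 = numOnes n (psiPair π).2) ∧
    (psiPair π = (pSeq π, qSeq π) ↔
      pSeq π ∈ Astar n (lis π.1) ∧ qSeq π ∈ FixedSeq n (lis π.1) (ldes π.1)) := by
  have hp := isBallot_pSeq π
  have hq := isBallot_qSeq π
  have kp := numOnes_pSeq π
  have kq := numOnes_qSeq π
  have hd := ldes_eq_del π
  have hor := pSeq_mem_A_or π
  unfold psiPair
  split_ifs with h1 h2 h3
  · obtain ⟨a1, a2, a3⟩ := hp.phi h1.2.2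
    refine ⟨⟨a1, hq, by simp only [a2, kp, kq]⟩, ?_⟩
    constructor
    · intro h; exact absurd (Prod.ext_iff.1 h).1 a3
    · rintro ⟨h, -⟩; exact absurd h.2.2 h1.2.2.ne'
  · obtain ⟨a1, a2, a3⟩ := hq.phi h2.2.1.2.2
    refine ⟨⟨hp, a1, by simp only [a2, kp, kq]⟩, ?_⟩
    constructor
    · intro h; exact absurd (Prod.ext_iff.1 h).2 a3
    · rintro ⟨-, h⟩; exact absurd h2.2 h.2.2.2.1
  · obtain ⟨a1, a2, a3⟩ := hq.psi kq hd.symm h3.2.1 h3.2.2.1 h3.2.2.2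
    refine ⟨⟨hp, a1, by simp only [a2, kp, kq]⟩, ?_⟩
    constructor
    · intro h; exact absurd (Prod.ext_iff.1 h).2 a3
    · rintro ⟨-, h⟩; exact absurd h3.2 h.2.2.2.2
  · refine ⟨⟨hp, hq, by simp only [kp, kq]⟩, ?_⟩
    have h4 := hor.resolve_left h1
    simp only [true_iff]
    exact ⟨h4, hq, kq, hd.symm, fun h => h2 ⟨h4, h⟩, fun h => h3 ⟨h4, h⟩⟩

theorem existsUnique_isPsi {n : ℕ} (π : T n) : ∃! σ : T n, IsPsi π σ := by
  obtain ⟨⟨h1, h2, h3⟩, -⟩ := psiPair_spec π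
  obtain ⟨σ, e1, e2⟩ := exists_pSeq_qSeq_eq h1 h2 h3
  refine ⟨σ, Prod.ext e1 e2, fun τ hτ => ?_⟩
  have := Prod.ext_iff.1 hτ
  exact eq_of_pSeq_eq_of_qSeq_eq (this.1.trans e1.symm) (this.2.trans e2.symm)

theorem psi_eq_self_iff {n : ℕ} (π : T n) : Psi π = π ↔
    pSeq π ∈ Astar n (lis π.1) ∧ qSeq π ∈ FixedSeq n (lis π.1) (ldes π.1) := by
  obtain ⟨σ, h1, h2⟩ := existsUnique_isPsi π
  have h3 : IsPsi π (Psi π) := Classical.epsilon_spec ⟨σ, h1⟩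
  rw [← (psiPair_spec π).2]
  constructor
  · intro h
    rw [h] at h3
    exact h3.symm
  · intro h
    exact (h2 _ h3).trans (h2 π h.symm).symm

/-! ### Fixed points as pairs with independent conditions. -/

theorem finite_isBallot (n : ℕ) : {c | IsBallot n c}.Finite := by
  induction n with
  | zero =>
    refine (Set.finite_singleton 0).subset fun c hc => ?_
    funext i
    exact hc.eq_zero (by omega)
  | succ n ih =>
    refine (Set.Finite.image2 (fun c v => Function.update c (n + 1) v) ih
      (Set.toFinite ({1, -1} : Set ℤ))).subset fun c hc => ?_
    refine ⟨trunc n c, hc.trunc (Nat.le_succ n), c (n + 1), by simpa using hc.pm (by omega) le_rfl, ?_⟩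
    funext i
    change Function.update (trunc n c) (n + 1) (c (n + 1)) i = c i
    rw [Function.update_apply]
    split_ifs with h
    · rw [h]
    · rcases Nat.lt_or_ge i (n + 1) with h1 | h1
      · exact trunc_apply c (by omega)
      · rw [hc.eq_zero (by omega)]; simp [trunc]; intro; omega

theorem f_eq_sum (n d : ℕ) :
    f n d = ∑ k ∈ Finset.range (n + 1), (Astar n k).ncard * (FixedSeq n k d).ncard := by
  rw [Finset.sum_range]
  have hA : ∀ k, Finite (Astar n k) := fun k =>
    ((finite_isBallot n).subset fun c hc => hc.1).to_subtype
  have hF : ∀ k, Finite (FixedSeq n k d) := fun k =>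
    ((finite_isBallot n).subset fun c hc => hc.1).to_subtype
  have hk : ∀ π : T n, lis π.1 < n + 1 := fun π => by
    rw [← numOnes_pSeq]; exact Nat.lt_succ_of_le (numOnes_le _ _)
  let g : {π : T n // Psi π = π ∧ ldes π.1 = d} →
      Σ k : Fin (n + 1), (Astar n k) × (FixedSeq n k d) := fun π =>
    ⟨⟨lis π.1.1, hk π.1⟩, ⟨pSeq π.1, ((psi_eq_self_iff π.1).1 π.2.1).1⟩,
      ⟨qSeq π.1, by simpa only [π.2.2] using ((psi_eq_self_iff π.1).1 π.2.1).2⟩⟩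
  have hg : Function.Bijective g := by
    constructor
    · rintro ⟨π, hπ⟩ ⟨σ, hσ⟩ h
      have h1 : ∀ x y : Σ k : Fin (n + 1), (Astar n k) × (FixedSeq n k d), x = y →
          x.2.1.1 = y.2.1.1 ∧ x.2.2.1 = y.2.2.1 := by rintro x _ rfl; exact ⟨rfl, rfl⟩
      obtain ⟨h2, h3⟩ := h1 _ _ h
      exact Subtype.ext (eq_of_pSeq_eq_of_qSeq_eq h2 h3)
    · rintro ⟨⟨k, hk'⟩, ⟨p, hp⟩, ⟨q, hq⟩⟩
      obtain ⟨π, rfl, rfl⟩ := exists_pSeq_qSeq_eq hp.1 hq.1 (hp.2.1.trans hq.2.1.symm)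
      have h1 : lis π.1 = k := by rw [← numOnes_pSeq]; exact hp.2.1
      subst h1
      have h2 : ldes π.1 = d := by rw [ldes_eq_del]; exact hq.2.2.1
      exact ⟨⟨π, (psi_eq_self_iff π).2 ⟨hp, by rw [h2]; exact hq⟩, h2⟩, rfl⟩
  rw [f, Nat.card_congr (Equiv.ofBijective g hg), Nat.card_sigma]
  refine Finset.sum_congr rfl fun k _ => ?_
  rw [Nat.card_prod, Nat.card_coe_set_eq, Nat.card_coe_set_eq]

/-! ### Counting ballot sequences -/

theorem update_apply_le {n i : ℕ} (c : ℕ → ℤ) (v : ℤ) (h : i ≤ n) :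
    Function.update c (n + 1) v i = c i := Function.update_of_ne (by omega) _ _

theorem update_apply_last (n : ℕ) (c : ℕ → ℤ) (v : ℤ) :
    Function.update c (n + 1) v (n + 1) = v := Function.update_self _ _ _

theorem height_update (n : ℕ) (c : ℕ → ℤ) (v : ℤ) :
    height (Function.update c (n + 1) v) (n + 1) = height c n + v := by
  rw [height_succ, update_apply_last, height_congr (fun i hi => update_apply_le c v hi)]

theorem numOnes_update_one (n : ℕ) (c : ℕ → ℤ) :
    numOnes (n + 1) (Function.update c (n + 1) 1) = numOnes n c + 1 := by
  rw [numOnes_succ, update_apply_last, numOnes_congr (fun i hi => update_apply_le c 1 hi)]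
  simp

theorem numOnes_update_neg (n : ℕ) (c : ℕ → ℤ) :
    numOnes (n + 1) (Function.update c (n + 1) (-1)) = numOnes n c := by
  rw [numOnes_succ, update_apply_last, numOnes_congr (fun i hi => update_apply_le c (-1) hi)]
  simp

theorem pairEq_update_of_le {n m : ℕ} (c : ℕ → ℤ) (v : ℤ) (h : m ≤ n) :
    PairEq m (Function.update c (n + 1) v) ↔ PairEq m c := by
  refine forall_congr' fun i => forall_congr' fun h1 => forall_congr' fun h2 =>
    forall_congr' fun _ => ?_
  rw [update_apply_le c v (by omega), update_apply_le c v (by omega)]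

theorem pairEq_succ_of_odd {n : ℕ} (hn : Odd n) (c : ℕ → ℤ) : PairEq (n + 1) c ↔ PairEq n c := by
  refine ⟨fun h => h.mono (Nat.le_succ n), fun h i h1 h2 h3 => h i h1 ?_ h3⟩
  refine lt_of_le_of_ne (by omega) ?_
  rintro rfl
  exact (Nat.not_even_iff_odd.2 hn) h3

theorem pairEq_succ_of_even {n : ℕ} (hn : Even n) (h0 : 1 ≤ n) (c : ℕ → ℤ) :
    PairEq (n + 1) c ↔ PairEq n c ∧ c n = c (n + 1) := by
  refine ⟨fun h => ⟨h.mono (Nat.le_succ n), h n h0 (by omega) hn⟩, fun h i h1 h2 h3 => ?_⟩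
  rcases Nat.lt_or_ge i n with h4 | h4
  · exact h.1 i h1 h4 h3
  · obtain rfl : i = n := by omega
    exact h.2

theorem IsBallot.update {n : ℕ} {c : ℕ → ℤ} (h : IsBallot n c) {v : ℤ} (hv : v = 1 ∨ v = -1)
    (h1 : 0 ≤ height c n + v) : IsBallot (n + 1) (Function.update c (n + 1) v) := by
  refine isBallot_of ?_ ?_ ?_
  · intro i hi hn
    rcases Nat.lt_or_ge i (n + 1) with h2 | h2
    · rw [update_apply_le c v (by omega)]; exact h.pm hi (by omega)
    · obtain rfl : i = n + 1 := by omega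
      rw [update_apply_last]; exact hv
  · intro i hi
    rw [Function.update_of_ne (by omega)]
    exact h.eq_zero (by omega)
  · intro j hj
    rcases Nat.lt_or_ge j (n + 1) with h2 | h2
    · rw [height_congr (fun i hi => update_apply_le c v (by omega))]
      exact h.height_nonneg (by omega)
    · obtain rfl : j = n + 1 := by omega
      rw [height_update]; exact h1

theorem IsBallot.update_injOn (n : ℕ) (v : ℤ) (s : Set (ℕ → ℤ)) (hs : ∀ c ∈ s, IsBallot n c) :
    Set.InjOn (fun c => Function.update c (n + 1) v) s := by
  intro c hc c' hc' h
  funext i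
  by_cases hi : i ≤ n
  · have := congrFun h i
    simpa only [update_apply_le _ _ hi] using this
  · rw [(hs c hc).eq_zero (by omega), (hs c' hc').eq_zero (by omega)]

theorem update_trunc {n : ℕ} {c : ℕ → ℤ} (h : IsBallot (n + 1) c) :
    Function.update (trunc n c) (n + 1) (c (n + 1)) = c := by
  funext i
  rcases lt_trichotomy i (n + 1) with h1 | rfl | h1
  · rw [update_apply_le _ _ (by omega), trunc_apply c (by omega)]
  · rw [update_apply_last]
  · rw [Function.update_of_ne (by omega), h.eq_zero (by omega), trunc, if_neg (by omega)]

/-- Splitting by the last term: appending `1` is always allowed, appending `-1` exactly when the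
partial sum is positive. -/
theorem ncard_isBallot_succ (n : ℕ) (P : (ℕ → ℤ) → Prop) :
    {c | IsBallot (n + 1) c ∧ P c}.ncard =
      {c | IsBallot n c ∧ P (Function.update c (n + 1) 1)}.ncard +
      {c | IsBallot n c ∧ 1 ≤ height c n ∧ P (Function.update c (n + 1) (-1))}.ncard := by
  set S₁ := {c | IsBallot n c ∧ P (Function.update c (n + 1) 1)}
  set S₂ := {c | IsBallot n c ∧ 1 ≤ height c n ∧ P (Function.update c (n + 1) (-1))}
  have f₁ : S₁.Finite := (finite_isBallot n).subset fun c hc => hc.1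
  have f₂ : S₂.Finite := (finite_isBallot n).subset fun c hc => hc.1
  have hU : {c | IsBallot (n + 1) c ∧ P c} =
      (fun c => Function.update c (n + 1) 1) '' S₁ ∪
      (fun c => Function.update c (n + 1) (-1)) '' S₂ := by
    ext c
    constructor
    · rintro ⟨hc, hP⟩
      have hu := update_trunc hc
      have ht := hc.trunc (Nat.le_succ n)
      have hh := hc.height_nonneg (le_refl (n + 1))
      rw [← hu, height_update] at hh
      rcases hc.pm (by omega) le_rfl with h1 | h1 <;> rw [h1] at hu hh
      · exact Or.inl ⟨trunc n c, ⟨ht, by rwa [hu]⟩, hu⟩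
      · exact Or.inr ⟨trunc n c, ⟨ht, by omega, by rwa [hu]⟩, hu⟩
    · rintro (⟨c, ⟨h1, h2⟩, rfl⟩ | ⟨c, ⟨h1, h2, h3⟩, rfl⟩)
      · exact ⟨h1.update (Or.inl rfl) (by have := h1.height_nonneg le_rfl; omega), h2⟩
      · exact ⟨h1.update (Or.inr rfl) (by omega), h3⟩
  rw [hU, Set.ncard_union_eq ?_ (f₁.image _) (f₂.image _),
    (IsBallot.update_injOn n _ _ fun c hc => hc.1).ncard_image,
    (IsBallot.update_injOn n _ _ fun c hc => hc.1).ncard_image]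
  rw [Set.disjoint_left]
  rintro _ ⟨c, -, rfl⟩ ⟨c', -, h⟩
  have := congrFun h (n + 1)
  simp only [update_apply_last] at this
  norm_num at this

/-- The number of `c` in a family of ballot sequences of odd length whose terms agree in pairs. -/
noncomputable def pairCount (m : ℕ) (G : ℕ → Prop) : ℕ :=
  {c | IsBallot (2 * m + 1) c ∧ PairEq (2 * m + 1) c ∧ G (numOnes (2 * m + 1) c)}.ncard

theorem pairCount_congr {m : ℕ} {G G' : ℕ → Prop} (h : ∀ s, G s ↔ G' s) :
    pairCount m G = pairCount m G' := by
  rw [show G = G' from funext fun s => propext (h s)]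

theorem ncard_eq_zero_of {P : (ℕ → ℤ) → Prop} (h : ∀ c, ¬ P c) : {c | P c}.ncard = 0 := by
  rw [show {c | P c} = ∅ from Set.eq_empty_of_forall_notMem h, Set.ncard_empty]

theorem ncard_congr_iff {P Q : (ℕ → ℤ) → Prop} (h : ∀ c, P c ↔ Q c) :
    {c | P c}.ncard = {c | Q c}.ncard := by
  rw [show P = Q from funext fun c => propext (h c)]

theorem isBallot_zero_iff (c : ℕ → ℤ) : IsBallot 0 c ↔ c = 0 := by
  constructor
  · intro h; funext i; exact h.eq_zero (by omega)
  · rintro rfl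
    refine isBallot_of (by omega) (by simp) ?_
    intro j hj
    obtain rfl : j = 0 := by omega
    rw [height_zero]

theorem ncard_isBallot_zero_and (P : (ℕ → ℤ) → Prop) [Decidable (P 0)] :
    {c | IsBallot 0 c ∧ P c}.ncard = if P 0 then 1 else 0 := by
  split_ifs with h
  · rw [ncard_congr_iff (Q := fun c => c = 0)]
    · exact Set.ncard_singleton 0
    · intro c
      rw [isBallot_zero_iff]
      exact ⟨fun h => h.1, fun h' => ⟨h', h' ▸ h⟩⟩
  · refine ncard_eq_zero_of ?_
    rintro c ⟨h1, h2⟩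
    rw [isBallot_zero_iff] at h1
    exact h (h1 ▸ h2)

theorem pairCount_zero (G : ℕ → Prop) [Decidable (G 1)] :
    pairCount 0 G = if G 1 then 1 else 0 := by
  unfold pairCount
  have h1 := ncard_isBallot_succ 0 (fun c => PairEq 1 c ∧ G (numOnes 1 c))
  have h2 : {c | IsBallot 0 c ∧ 1 ≤ height c 0 ∧
      PairEq 1 (Function.update c (0 + 1) (-1)) ∧ G (numOnes 1 (Function.update c (0 + 1) (-1)))}.ncard = 0 := by
    refine ncard_eq_zero_of ?_
    rintro c ⟨-, h, -⟩
    rw [height_zero] at h; omega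
  rw [h2, add_zero] at h1
  simp only [Nat.mul_zero, zero_add] at *
  rw [h1, ncard_congr_iff (Q := fun c => IsBallot 0 c ∧ G 1)]
  · exact ncard_isBallot_zero_and (fun _ => G 1)
  · intro c
    have h3 := numOnes_update_one 0 c
    rw [numOnes_zero, zero_add] at h3
    rw [h3]
    have : PairEq 1 (Function.update c 1 1) := fun i a1 a2 _ => by omega
    tauto

/-- A ballot sequence of length `2m + 2` with paired terms arises from one of length `2m + 1`. -/
theorem ncard_isBallot_even (m : ℕ) (G : ℕ → Prop) :
    {c | IsBallot (2 * m + 2) c ∧ PairEq (2 * m + 2) c ∧ G (numOnes (2 * m + 2) c)}.ncard =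
      pairCount m (fun s => G (s + 1)) + pairCount m G := by
  have hodd : Odd (2 * m + 1) := ⟨m, rfl⟩
  rw [ncard_isBallot_succ (2 * m + 1) (fun c => PairEq (2 * m + 2) c ∧ G (numOnes (2 * m + 2) c))]
  unfold pairCount
  congr 1
  · refine ncard_congr_iff fun c => ?_
    rw [pairEq_succ_of_odd hodd, pairEq_update_of_le _ _ le_rfl, numOnes_update_one]
  · refine ncard_congr_iff fun c => ?_
    rw [pairEq_succ_of_odd hodd, pairEq_update_of_le _ _ le_rfl, numOnes_update_neg]
    constructor
    · rintro ⟨h1, -, h2⟩; exact ⟨h1, h2⟩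
    · rintro ⟨h1, h2⟩
      refine ⟨h1, ?_, h2⟩
      -- At an odd position the partial sum is odd, so nonnegative means positive and a `-1` may
      -- always follow.
      have h3 := h1.height_nonneg le_rfl
      have h4 := h1.height_eq le_rfl
      push_cast at h4
      omega

/-- The last two terms are equal. Appending two `-1` requires the partial sum `2k - (2m + 1)` to be
at least 2, which is the condition in the second summand. -/
theorem pairCount_succ (m k : ℕ) : pairCount (m + 1) (· = k) =
    pairCount m (fun s => s + 2 = k) +
      if 2 * m + 3 ≤ 2 * k then pairCount m (· = k) else 0 := by
  have hodd : Odd (2 * m + 1) := ⟨m, rfl⟩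
  have heven : Even (2 * m + 1 + 1) := ⟨m + 1, by ring⟩
  have h1 := ncard_isBallot_succ (2 * m + 1 + 1)
    (fun c => PairEq (2 * m + 1 + 1 + 1) c ∧ numOnes (2 * m + 1 + 1 + 1) c = k)
  have h2 := ncard_isBallot_succ (2 * m + 1)
    (fun c => PairEq (2 * m + 1) c ∧ c (2 * m + 1 + 1) = 1 ∧ numOnes (2 * m + 1 + 1) c + 1 = k)
  have h3 := ncard_isBallot_succ (2 * m + 1)
    (fun c => 1 ≤ height c (2 * m + 1 + 1) ∧ PairEq (2 * m + 1) c ∧ c (2 * m + 1 + 1) = -1 ∧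
      numOnes (2 * m + 1 + 1) c = k)
  have e1 : ∀ (c : ℕ → ℤ) (v : ℤ), PairEq (2 * m + 1 + 1 + 1) (Function.update c (2 * m + 1 + 1 + 1) v) ↔
      PairEq (2 * m + 1) c ∧ c (2 * m + 1 + 1) = v := by
    intro c v
    rw [pairEq_succ_of_even heven (by omega), pairEq_succ_of_odd hodd,
      pairEq_update_of_le _ _ (by omega), update_apply_le _ _ le_rfl, update_apply_last]
  simp only [e1, numOnes_update_one, numOnes_update_neg] at h1
  simp only [pairEq_update_of_le _ _ (le_refl (2 * m + 1)), update_apply_last, numOnes_update_one,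
    numOnes_update_neg, height_update] at h2 h3
  unfold pairCount
  rw [show 2 * (m + 1) + 1 = 2 * m + 1 + 1 + 1 by ring, h1]
  simp only [and_assoc]
  rw [h2, h3]
  rw [ncard_eq_zero_of (P := fun c => IsBallot (2 * m + 1) c ∧ 1 ≤ height c (2 * m + 1) ∧
      PairEq (2 * m + 1) c ∧ (-1 : ℤ) = 1 ∧ numOnes (2 * m + 1) c + 1 = k) (by norm_num),
    ncard_eq_zero_of (P := fun c => IsBallot (2 * m + 1) c ∧ 1 ≤ height c (2 * m + 1) + 1 ∧
      PairEq (2 * m + 1) c ∧ (1 : ℤ) = -1 ∧ numOnes (2 * m + 1) c + 1 = k) (by norm_num)]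
  rw [add_zero, zero_add]
  congr 1
  · refine ncard_congr_iff fun c => ?_
    simp [add_assoc]
  · split_ifs with hk
    · refine ncard_congr_iff fun c => ?_
      constructor
      · rintro ⟨a1, -, -, a2, -, a3⟩; exact ⟨a1, a2, a3⟩
      · rintro ⟨a1, a2, a3⟩
        have h4 := a1.height_eq le_rfl
        push_cast at h4
        exact ⟨a1, by omega, by omega, a2, trivial, a3⟩
    · refine ncard_eq_zero_of fun c => ?_
      rintro ⟨a1, a4, a5, a2, -, a3⟩
      have h4 := a1.height_eq le_rfl
      push_cast at h4
      omega

theorem pairCount_even (m r : ℕ) : pairCount m (· = 2 * r) = 0 := by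
  refine ncard_eq_zero_of ?_
  rintro c ⟨h1, h2, h3⟩
  obtain ⟨s, hs⟩ := numOnes_odd h1 h2
  omega

/-! ### Ballot numbers and the sizes of the sets `A*`. -/

/-- The number of ballot sequences of length `m` with `r` ones. -/
def ballotNum (m r : ℕ) : ℤ :=
  if m ≤ 2 * r then (m.choose r : ℤ) - m.choose (r + 1) else 0

/-- The formula remains valid one step outside the ballot range, where both binomial coefficients
agree; the window sums use this slack. -/
theorem ballotNum_eq {m r : ℕ} (h : m ≤ 2 * r + 1) :
    ballotNum m r = (m.choose r : ℤ) - m.choose (r + 1) := by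
  unfold ballotNum
  split_ifs with h1
  · rfl
  · obtain rfl : m = 2 * r + 1 := by omega
    rw [Nat.choose_symm_half, sub_self]

theorem ballotNum_eq_zero {m r : ℕ} (h : 2 * r < m) : ballotNum m r = 0 := if_neg (by omega)

theorem ballotNum_eq_zero' {m r : ℕ} (h : m < r) : ballotNum m r = 0 := by
  rw [ballotNum_eq (by omega), Nat.choose_eq_zero_of_lt h, Nat.choose_eq_zero_of_lt (by omega)]
  simp

theorem ballotNum_succ (m r : ℕ) : ballotNum (m + 1) (r + 1) =
    ballotNum m r + if m + 1 ≤ 2 * (r + 1) then ballotNum m (r + 1) else 0 := by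
  split_ifs with h
  · rw [ballotNum_eq (by omega), ballotNum_eq (m := m) (by omega), ballotNum_eq (by omega),
      Nat.choose_succ_succ, Nat.choose_succ_succ]
    push_cast; ring
  · rw [ballotNum_eq_zero (by omega), ballotNum_eq_zero (by omega), add_zero]

/-- Dropping the initial `1` and halving the pairs gives ballot sequences of length `m` with `r`
ones: a partial sum `1 + 2h` is nonnegative exactly when `h` is. In the proof this appears as a
common recursion. -/
theorem pairCount_odd (m : ℕ) : ∀ r, (pairCount m (· = 2 * r + 1) : ℤ) = ballotNum m r := by
  induction m with
  | zero =>
    intro r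
    rw [pairCount_zero]
    rcases r with _ | r
    · simp [ballotNum]
    · rw [ballotNum_eq_zero' (by omega), if_neg (by omega)]; rfl
  | succ m ih =>
    intro r
    rw [pairCount_succ]
    rcases r with _ | r
    · rw [if_neg (by omega), ballotNum_eq_zero (by omega),
        pairCount_congr (G := fun s => s + 2 = 2 * 0 + 1) (fun s => iff_false_intro (by omega))]
      unfold pairCount
      rw [ncard_eq_zero_of (by tauto)]
      simp
    · rw [ballotNum_succ, pairCount_congr (G' := (· = 2 * r + 1)) (fun s => by omega)]
      push_cast
      rw [ih, ih]
      congr 1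
      by_cases h : m + 1 ≤ 2 * (r + 1)
      · rw [if_pos h, if_pos (by omega)]
      · rw [if_neg h, if_neg (by omega)]

open Classical in
theorem pairCount_eq_sum (m : ℕ) (G : ℕ → Prop) : (pairCount m G : ℤ) =
    ∑ s ∈ Finset.range (m + 1), if G (2 * s + 1) then ballotNum m s else 0 := by
  set S := {c | IsBallot (2 * m + 1) c ∧ PairEq (2 * m + 1) c ∧ G (numOnes (2 * m + 1) c)} with hS
  have hfin : S.Finite := (finite_isBallot (2 * m + 1)).subset fun c hc => hc.1
  have h1 : pairCount m G = hfin.toFinset.card := Set.ncard_eq_toFinset_card S hfin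
  rw [h1, Finset.card_eq_sum_card_fiberwise (f := fun c => numOnes (2 * m + 1) c / 2)
    (t := Finset.range (m + 1))]
  · push_cast
    refine Finset.sum_congr rfl fun s _ => ?_
    rw [← pairCount_odd]
    have h2 : ((hfin.toFinset.filter fun c => numOnes (2 * m + 1) c / 2 = s).card : ℤ) =
        pairCount m (fun t => t = 2 * s + 1 ∧ G t) := by
      rw [pairCount, ← Set.ncard_coe_finset]
      congr 2
      ext c
      simp only [Finset.coe_filter, Set.Finite.mem_toFinset, hS, Set.mem_ofPred_eq]
      constructor
      · rintro ⟨⟨a1, a2, a3⟩, a4⟩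
        obtain ⟨r, hr⟩ := numOnes_odd a1 a2
        exact ⟨a1, a2, by omega, a3⟩
      · rintro ⟨a1, a2, a3, a4⟩
        exact ⟨⟨a1, a2, a4⟩, by omega⟩
    rw [h2]
    split_ifs with hG
    · congr 1
      refine pairCount_congr fun t => ⟨fun h => h.1, fun h => ⟨h, h ▸ hG⟩⟩
    · rw [pairCount, ncard_eq_zero_of]
      · rfl
      · rintro c ⟨-, -, a3, a4⟩
        exact hG (a3 ▸ a4)
  · intro c _
    have := numOnes_le (2 * m + 1) c
    simp only [Finset.coe_range, Set.mem_Iio]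
    omega

theorem mem_Astar_iff {n k : ℕ} (c : ℕ → ℤ) :
    c ∈ Astar n k ↔ IsBallot n c ∧ PairEq n c ∧ numOnes n c = k := by
  constructor
  · rintro ⟨h1, h2, h3⟩
    exact ⟨h1, (h1.pairEq_iff le_rfl).2 (Or.inl h3), h2⟩
  · rintro ⟨h1, h2, h3⟩
    refine ⟨h1, h3, ?_⟩
    rcases (h1.pairEq_iff le_rfl).1 h2 with h4 | h4
    · exact h4
    · rcases eps_spec n c with ⟨h5, -⟩ | ⟨-, h5, -⟩ <;> omega

theorem ncard_Astar_odd (m k : ℕ) : (Astar (2 * m + 1) k).ncard = pairCount m (· = k) := by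
  rw [pairCount]
  congr 1
  ext c
  exact mem_Astar_iff c

theorem ncard_Astar_even (m k : ℕ) : (Astar (2 * m + 2) k).ncard =
    pairCount m (fun s => s + 1 = k) + pairCount m (· = k) := by
  rw [← ncard_isBallot_even m (· = k)]
  congr 1
  ext c
  exact mem_Astar_iff c

/-- The first `2m + 1` terms contain an odd number of ones, so the parity of `k` forces the last
term; here it is `-1`. -/
theorem ncard_Astar_even_odd (m r : ℕ) :
    ((Astar (2 * m + 2) (2 * r + 1)).ncard : ℤ) = ballotNum m r := by
  rw [ncard_Astar_even, pairCount_congr (G' := (· = 2 * r)) (fun s => by omega), pairCount_even,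
    zero_add, pairCount_odd]

theorem ncard_Astar_even_even (m r : ℕ) :
    ((Astar (2 * m + 2) (2 * r + 2)).ncard : ℤ) = ballotNum m r := by
  rw [ncard_Astar_even, pairCount_congr (G' := (· = 2 * r + 1)) (fun s => by omega),
    show 2 * r + 2 = 2 * (r + 1) by ring, pairCount_even, add_zero, pairCount_odd]

theorem ncard_Astar_even_zero (m : ℕ) : (Astar (2 * m + 2) 0).ncard = 0 := by
  refine ncard_eq_zero_of ?_
  rintro c ⟨h1, h2, -⟩
  have h3 := h1.first (by omega)
  rw [numOnes, Finset.card_eq_zero] at h2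
  have : 1 ∈ (Finset.Icc 1 (2 * m + 2)).filter (fun i => c i = 1) := by simp [h3]
  rw [h2] at this
  simp at this

/-! ### Sequences with a given last descent -/

/-- The sequence `c` of length `d`, followed by `a` terms `-1` and then by terms `1`, up to
length `n`. -/
def attach (n d a : ℕ) (c : ℕ → ℤ) : ℕ → ℤ := fun i =>
  if i ≤ d then c i else if i ≤ d + a then -1 else if i ≤ n then 1 else 0

theorem attach_le {n d a i : ℕ} (c : ℕ → ℤ) (h : i ≤ d) : attach n d a c i = c i := if_pos h

theorem attach_mid {n d a i : ℕ} (c : ℕ → ℤ) (h : d < i) (h' : i ≤ d + a) :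
    attach n d a c i = -1 := by rw [attach, if_neg (by omega), if_pos h']

theorem attach_high {n d a i : ℕ} (c : ℕ → ℤ) (h : d + a < i) (h' : i ≤ n) :
    attach n d a c i = 1 := by rw [attach, if_neg (by omega), if_neg (by omega), if_pos h']

theorem numOnes_tail {n d a : ℕ} {q : ℕ → ℤ} (h : ∀ i, 1 ≤ i → i ≤ n → q i = 1 ∨ q i = -1)
    (han : d + a ≤ n) (ht1 : ∀ i, d < i → i ≤ d + a → q i = -1)
    (ht2 : ∀ i, d + a < i → i ≤ n → q i = 1) : numOnes n q + d + a = numOnes d q + n := by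
  have g1 := height_eq_of_pm h n le_rfl
  have g2 := height_eq_of_pm h d (by omega)
  have g3 := height_add_of_const ht1
  have g4 := height_add_of_const (c := q) (d := d + a) (a := n - (d + a)) (v := 1)
    (fun i h1 h2 => ht2 i h1 (by omega))
  rw [Nat.add_sub_cancel' han] at g4
  omega

/-- The condition on the number `s` of ones among the first `d` terms which ensures that there is a
ballot sequence of length `n` with `k` ones and last descent `d`. -/
def TailCond (n k d s : ℕ) : Prop := k + d < s + n ∧ s ≤ k ∧ n ≤ s + k

/-- Truncation at `d` is a bijection: with `s` ones up to `d`, the tail must consist of `a = s + n -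
k - d` terms `-1` followed by `k - s` terms `1`. The three parts of `TailCond` say that `a ≥ 1`,
that `k - s ≥ 0`, and that the partial sum at `d + a` is nonnegative. -/
theorem ncard_tail {n d : ℕ} (k : ℕ) (h0 : 1 ≤ d) (hdn : d < n) (R : (ℕ → ℤ) → Prop) :
    {q | IsBallot n q ∧ numOnes n q = k ∧ del n q = d ∧ R (trunc d q)}.ncard =
      {c | IsBallot d c ∧ c d = 1 ∧ TailCond n k d (numOnes d c) ∧ R c}.ncard := by
  have key : ∀ q, IsBallot n q → numOnes n q = k → del n q = d →
      ∃ a, 1 ≤ a ∧ d + a ≤ n ∧ q d = 1 ∧ k + d + a = numOnes d q + n ∧ q = attach n d a q ∧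
        0 ≤ height q d - a := by
    intro q h1 h2 h3
    obtain ⟨a, ha, han, hd, ht1, ht2⟩ := h1.exists_tail h3 h0
    refine ⟨a, ha, han, hd, ?_, ?_, ?_⟩
    · rw [← h2]; exact numOnes_tail (q := q) (fun i a1 a2 => h1.pm a1 a2) han ht1 ht2
    · funext i
      unfold attach
      split_ifs with b1 b2 b3
      · rfl
      · exact ht1 i (by omega) b2
      · exact ht2 i (by omega) b3
      · exact h1.eq_zero (by omega)
    · have := h1.height_nonneg han
      rw [height_add_of_const ht1] at this
      omega
  have himg : {c | IsBallot d c ∧ c d = 1 ∧ TailCond n k d (numOnes d c) ∧ R c} =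
      trunc d '' {q | IsBallot n q ∧ numOnes n q = k ∧ del n q = d ∧ R (trunc d q)} := by
    ext c
    constructor
    · rintro ⟨h1, h2, ⟨h3, h4, h5⟩, h6⟩
      obtain ⟨a, ha⟩ : ∃ a, k + d + a = numOnes d c + n := ⟨numOnes d c + n - (k + d), by omega⟩
      have htr : trunc d (attach n d a c) = c := by
        funext i
        by_cases hi : i ≤ d
        · rw [trunc_apply _ hi, attach_le _ hi]
        · rw [trunc, if_neg hi, h1.eq_zero (by omega)]
      have han : d + a ≤ n := by omega
      have hpm : ∀ i, 1 ≤ i → i ≤ n → attach n d a c i = 1 ∨ attach n d a c i = -1 := by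
        intro i b1 b2
        unfold attach
        split_ifs with b3 b4
        · exact h1.pm b1 b3
        · simp
        · simp
      have hm : ∀ i, d < i → i ≤ d + a → attach n d a c i = -1 := fun i => attach_mid c
      have hh : ∀ i, d + a < i → i ≤ n → attach n d a c i = 1 := fun i => attach_high c
      have hhd : height (attach n d a c) d = height c d := height_congr fun i hi => attach_le c hi
      have hbal : IsBallot n (attach n d a c) := by
        refine isBallot_of hpm ?_ ?_
        · intro i hi
          unfold attach
          split_ifs with b1 b2 b3
          · exact h1.eq_zero (by omega)
          · omega
          · omega
          · rfl
        · have hmid : ∀ t ≤ a, 0 ≤ height (attach n d a c) (d + t) := by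
            intro t ht
            rw [height_add_of_const (v := -1) (fun i b1 b2 => hm i b1 (by omega)), hhd,
              h1.height_eq le_rfl]
            omega
          intro j hj
          rcases le_or_gt j d with b1 | b1
          · rw [height_congr fun i hi => attach_le c (hi.trans b1)]
            exact h1.height_nonneg b1
          · rcases le_or_gt j (d + a) with b2 | b2
            · obtain ⟨t, rfl⟩ := Nat.exists_eq_add_of_lt b1
              exact hmid (t + 1) (by omega)
            · obtain ⟨t, rfl⟩ := Nat.exists_eq_add_of_lt b2
              rw [add_assoc (d + a), height_add_of_const (v := 1)
                (fun i b1 b2 => hh i b1 (by omega))]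
              have := hmid a le_rfl
              positivity
      refine ⟨attach n d a c, ⟨hbal, ?_, ?_, by rwa [htr]⟩, htr⟩
      · have := numOnes_tail hpm han hm hh
        rw [numOnes_congr (j := d) (c' := c) fun i hi => attach_le c hi] at this
        omega
      · refine del_eq_of h0 hdn (by rw [attach_le c le_rfl, h2]) (hm _ (by omega) (by omega)) ?_
        rintro i b1 b2 ⟨b3, b4⟩
        rcases le_or_gt i (d + a) with b5 | b5
        · rw [hm i b1 b5] at b3; norm_num at b3
        · rw [hh (i + 1) (by omega) b2] at b4; norm_num at b4
    · rintro ⟨q, ⟨h1, h2, h3, h4⟩, rfl⟩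
      obtain ⟨a, ha, han, hd, hk, -, hht⟩ := key q h1 h2 h3
      have hn : numOnes d (trunc d q) = numOnes d q := numOnes_congr fun i hi => trunc_apply q hi
      rw [h1.height_eq hdn.le] at hht
      refine ⟨h1.trunc hdn.le, by rw [trunc_apply q le_rfl, hd], ?_, h4⟩
      rw [hn]
      exact ⟨by omega, by omega, by omega⟩
  rw [himg, Set.InjOn.ncard_image]
  rintro q ⟨h1, h2, h3, -⟩ q' ⟨h1', h2', h3', -⟩ h
  obtain ⟨a, -, -, -, hk, hq, -⟩ := key q h1 h2 h3
  obtain ⟨a', -, -, -, hk', hq', -⟩ := key q' h1' h2' h3'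
  have hqq : ∀ i ≤ d, q i = q' i := fun i hi => by
    have := congrFun h i
    rwa [trunc_apply q hi, trunc_apply q' hi] at this
  rw [numOnes_congr hqq] at hk
  obtain rfl : a = a' := by omega
  rw [hq, hq']
  funext i
  by_cases hi : i ≤ d
  · rw [attach_le _ hi, attach_le _ hi, hqq i hi]
  · simp only [attach, if_neg hi]

theorem IsBallot.notMem_B_iff {n k d : ℕ} {q : ℕ → ℤ} (h : IsBallot n q) (hk : numOnes n q = k)
    (hd : del n q = d) (hdn : d < n) : q ∉ B n k ↔ PairEq (d - 1) q := by
  rw [h.pairEq_iff (by omega)]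
  constructor
  · intro h1
    by_contra h2
    exact h1 ⟨⟨h, hk, by omega⟩, by omega⟩
  · rintro h1 ⟨⟨-, -, h2⟩, h3⟩
    omega

theorem ncard_fixedSeq_of_not {n k d : ℕ} (h0 : 1 ≤ d) (hdn : d < n)
    (h : ¬ (Even (n - k) ∧ Odd d)) : (FixedSeq n k d).ncard =
      {c | IsBallot d c ∧ c d = 1 ∧ TailCond n k d (numOnes d c) ∧ PairEq (d - 1) c}.ncard := by
  rw [← ncard_tail k h0 hdn]
  refine ncard_congr_iff fun q => ?_
  rw [PairEq.trunc (Nat.sub_le d 1)]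
  constructor
  · rintro ⟨h1, h2, h3, h4, -⟩
    exact ⟨h1, h2, h3, (h1.notMem_B_iff h2 h3 hdn).1 h4⟩
  · rintro ⟨h1, h2, h3, h4⟩
    exact ⟨h1, h2, h3, (h1.notMem_B_iff h2 h3 hdn).2 h4, fun h' => h h'.2⟩

/-- Here membership in `A*` and `B**` must be excluded too. If `q_{d-1} = q_d = 1`, the block of
`-1` has even length, so pairing continues to the end and `q` lies in `A*`. Hence `q_{d-1} = -1` and
`ε = d - 1`, and avoiding `B**` means that `q` ends in `-1`, so that all ones occur up to `d`. -/
theorem ncard_fixedSeq_of_odd {n k e : ℕ} (hdn : 2 * e + 1 < n) (h : Even (n - k)) :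
    (FixedSeq n k (2 * e + 1)).ncard =
      {c | IsBallot (2 * e + 1) c ∧ c (2 * e + 1) = 1 ∧ TailCond n k (2 * e + 1)
        (numOnes (2 * e + 1) c) ∧ PairEq (2 * e) c ∧ c (2 * e) = -1 ∧
        numOnes (2 * e + 1) c = k}.ncard := by
  rw [← ncard_tail k (by omega) hdn (fun c => PairEq (2 * e) c ∧ c (2 * e) = -1 ∧
        numOnes (2 * e + 1) c = k)]
  refine ncard_congr_iff fun q => ?_
  rw [PairEq.trunc (by omega), trunc_apply q (by omega),
    numOnes_congr (c' := q) fun i hi => trunc_apply q hi]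
  obtain ⟨u, hu⟩ := h
  constructor
  · rintro ⟨h1, h2, h3, h4, h5⟩
    have hp : PairEq (2 * e) q := (h1.notMem_B_iff h2 h3 hdn).1 h4
    have h5' : q ∉ Astar n k ∪ Bstarstar n k := fun h6 => h5 ⟨h6, ⟨u, hu⟩, ⟨e, rfl⟩⟩
    obtain ⟨a, ha, han, hd, ht1, ht2⟩ := h1.exists_tail h3 (by omega)
    have hnum := numOnes_tail (q := q) (fun i a1 a2 => h1.pm a1 a2) han ht1 ht2
    have hkn := numOnes_le n q
    have hA : eps n q ≠ 0 := fun h0 => h5' (Or.inl ⟨h1, h2, h0⟩)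
    have hneg : q (2 * e) = -1 ∧ 1 ≤ e := by
      by_contra hcon
      have hp1 : PairEq (2 * e + 1) q := by
        rcases Nat.eq_zero_or_pos e with rfl | he
        · intro i a1 a2; omega
        · rw [pairEq_succ_of_even ⟨e, by ring⟩ (by omega)]
          rcases h1.pm (i := 2 * e) (by omega) (by omega) with h6 | h6
          · exact ⟨hp, by rw [h6, hd]⟩
          · exact absurd ⟨h6, he⟩ hcon
      obtain ⟨r, hr⟩ := h1.numOnes_prefix_odd (m := e) (by omega) hp1
      have hpn : PairEq n q := by
        intro i a1 a2 a3
        obtain ⟨j, hj⟩ := a3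
        rcases Nat.lt_or_ge i (2 * e + 1) with b1 | b1
        · exact hp1 i a1 b1 ⟨j, hj⟩
        · rcases Nat.lt_or_ge i (2 * e + 1 + a) with b2 | b2
          · rw [ht1 i (by omega) b2.le, ht1 (i + 1) (by omega) b2]
          -- The two blocks of the tail meet after the odd position `d + a`, so no pair starting at
          -- an even position straddles them.
          · have : i ≠ 2 * e + 1 + a := by omega
            rw [ht2 i (by omega) a2.le, ht2 (i + 1) (by omega) a2]
      rcases (h1.pairEq_iff le_rfl).1 hpn with h6 | h6
      · exact hA h6
      · rcases eps_spec n q with ⟨h7, -⟩ | ⟨-, h7, -⟩ <;> omega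
    refine ⟨h1, h2, h3, hp, hneg.1, ?_⟩
    have hane : 2 * e + 1 + a = n := by
      by_contra hne
      apply h5'
      right
      refine ⟨⟨⟨h1, h2, by omega⟩, ?_⟩, ht2 n (by omega) le_rfl⟩
      rw [h3]
      have hle : 2 * e ≤ eps n q := ((h1.pairEq_iff (by omega)).1 hp).resolve_left hA
      have hnot : ¬ PairEq (2 * e + 1) q := by
        rw [pairEq_succ_of_even ⟨e, by ring⟩ (by omega), hneg.1, hd]
        rintro ⟨-, h6⟩; norm_num at h6
      rw [h1.pairEq_iff (by omega)] at hnot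
      omega
    omega
  · rintro ⟨h1, h2, h3, hp, hneg, hk⟩
    refine ⟨h1, h2, h3, (h1.notMem_B_iff h2 h3 hdn).2 hp, ?_⟩
    obtain ⟨a, ha, han, hd, ht1, ht2⟩ := h1.exists_tail h3 (by omega)
    have hnum := numOnes_tail (q := q) (fun i a1 a2 => h1.pm a1 a2) han ht1 ht2
    have he : 1 ≤ e := by
      by_contra hcon
      obtain rfl : e = 0 := by omega
      rw [h1.eq_zero (by omega)] at hneg
      norm_num at hneg
    rintro ⟨(h6 | h6), -⟩
    · have hA : PairEq n q := (h1.pairEq_iff le_rfl).2 (Or.inl h6.2.2)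
      have := hA (2 * e) (by omega) (by omega) ⟨e, by ring⟩
      rw [hneg, hd] at this; norm_num at this
    · have h7 := h6.2
      rw [ht1 n (by omega) (by omega)] at h7
      norm_num at h7

/-! ### The number of fixed sequences -/

theorem ncard_fixedSeq_even {n k e : ℕ} (hdn : 2 * e + 2 < n) :
    (FixedSeq n k (2 * e + 2)).ncard =
      pairCount e (fun s => TailCond n k (2 * e + 2) (s + 1)) := by
  rw [ncard_fixedSeq_of_not (by omega) hdn (by rintro ⟨-, r, hr⟩; omega),
    ncard_isBallot_succ (2 * e + 1) (fun c => c (2 * e + 2) = 1 ∧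
      TailCond n k (2 * e + 2) (numOnes (2 * e + 2) c) ∧ PairEq (2 * e + 2 - 1) c),
    ncard_eq_zero_of (P := fun c => IsBallot (2 * e + 1) c ∧ 1 ≤ height c (2 * e + 1) ∧
      Function.update c (2 * e + 1 + 1) (-1) (2 * e + 2) = 1 ∧
      TailCond n k (2 * e + 2) (numOnes (2 * e + 2) (Function.update c (2 * e + 1 + 1) (-1))) ∧
        PairEq (2 * e + 2 - 1) (Function.update c (2 * e + 1 + 1) (-1))), add_zero]
  · refine ncard_congr_iff fun c => ?_
    rw [update_apply_last, numOnes_update_one, pairEq_update_of_le _ _ (by omega)]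
    simp only [true_and]
    exact ⟨fun h => ⟨h.1, h.2.2, h.2.1⟩, fun h => ⟨h.1, h.2.2, h.2.1⟩⟩
  · rintro c ⟨-, -, h, -⟩
    rw [update_apply_last] at h
    norm_num at h

theorem ncard_last_one (d : ℕ) (P : (ℕ → ℤ) → Prop) :
    {c | IsBallot (d + 1) c ∧ c (d + 1) = 1 ∧ P c}.ncard =
      {c | IsBallot d c ∧ P (Function.update c (d + 1) 1)}.ncard := by
  rw [ncard_isBallot_succ d (fun c => c (d + 1) = 1 ∧ P c),
    ncard_eq_zero_of (P := fun c => IsBallot d c ∧ 1 ≤ height c d ∧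
      Function.update c (d + 1) (-1) (d + 1) = 1 ∧ P (Function.update c (d + 1) (-1))), add_zero]
  · refine ncard_congr_iff fun c => ?_
    rw [update_apply_last]
    simp
  · rintro c ⟨-, -, h, -⟩
    rw [update_apply_last] at h
    norm_num at h

/-- The term at `d - 1` is free, which gives one count for each of its values. -/
theorem ncard_fixedSeq_odd_of_odd {n k e : ℕ} (hdn : 2 * e + 3 < n) (h : Odd (n - k)) :
    (FixedSeq n k (2 * e + 3)).ncard =
      pairCount e (fun s => TailCond n k (2 * e + 3) (s + 2)) +
      pairCount e (fun s => TailCond n k (2 * e + 3) (s + 1)) := by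
  rw [ncard_fixedSeq_of_not (by omega) hdn (fun h' => (Nat.not_even_iff_odd.2 h) h'.1),
    ncard_last_one (2 * e + 2) (fun c => TailCond n k (2 * e + 3) (numOnes (2 * e + 3) c) ∧
      PairEq (2 * e + 3 - 1) c)]
  have h1 := ncard_isBallot_even e (fun s => TailCond n k (2 * e + 3) (s + 1))
  rw [← h1]
  refine ncard_congr_iff fun c => ?_
  rw [numOnes_update_one, pairEq_update_of_le _ _ (by omega)]
  simp only [show 2 * e + 3 - 1 = 2 * e + 2 from rfl]
  tauto

/-- The term at `d - 1` is forced to be `-1`, and the term at `d` supplies the last of the `k` ones.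
-/
theorem ncard_fixedSeq_odd_of_even {n k e : ℕ} (hdn : 2 * e + 3 < n) (h : Even (n - k)) :
    (FixedSeq n k (2 * e + 3)).ncard =
      pairCount e (fun s => s + 1 = k ∧ TailCond n k (2 * e + 3) (s + 1)) := by
  have hodd : Odd (2 * e + 1) := ⟨e, rfl⟩
  rw [show 2 * e + 3 = 2 * (e + 1) + 1 by ring] at hdn ⊢
  rw [ncard_fixedSeq_of_odd hdn h, ncard_last_one (2 * (e + 1)) (fun c =>
    TailCond n k (2 * (e + 1) + 1) (numOnes (2 * (e + 1) + 1) c) ∧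
      PairEq (2 * (e + 1)) c ∧ c (2 * (e + 1)) = -1 ∧ numOnes (2 * (e + 1) + 1) c = k)]
  simp only [numOnes_update_one, pairEq_update_of_le _ _ (le_refl (2 * (e + 1))),
    update_apply_le _ _ (le_refl (2 * (e + 1)))]
  rw [show 2 * (e + 1) = 2 * e + 1 + 1 by ring, ncard_isBallot_succ (2 * e + 1) (fun c =>
    TailCond n k (2 * e + 1 + 1 + 1) (numOnes (2 * e + 1 + 1) c + 1) ∧
      PairEq (2 * e + 1 + 1) c ∧ c (2 * e + 1 + 1) = -1 ∧ numOnes (2 * e + 1 + 1) c + 1 = k)]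
  simp only [numOnes_update_neg, pairEq_succ_of_odd hodd, pairEq_update_of_le _ _ (le_refl (2 * e + 1)),
    update_apply_last]
  rw [ncard_eq_zero_of, zero_add]
  · refine ncard_congr_iff fun c => ?_
    constructor
    · rintro ⟨h1, -, h2, h3, -, h4⟩; exact ⟨h1, h3, h4, h2⟩
    · rintro ⟨h1, h3, h4, h2⟩
      refine ⟨h1, ?_, h2, h3, trivial, h4⟩
      have h5 := h1.height_nonneg le_rfl
      have h6 := h1.height_eq le_rfl
      push_cast at h6
      omega
  · rintro c ⟨-, -, -, h1, -⟩
    norm_num at h1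

theorem ncard_fixedSeq_one {n k : ℕ} (hn : 1 < n) (hk : k ≤ n) : (FixedSeq n k 1).ncard =
    if k + 1 = n then 1 else 0 := by
  by_cases h : Even (n - k)
  · rw [ncard_fixedSeq_of_odd (e := 0) (by omega) h, ncard_eq_zero_of, if_neg]
    · rintro rfl
      rw [Nat.add_sub_cancel_left] at h
      exact absurd h (by decide)
    · rintro c ⟨h1, -, -, -, h2, -⟩
      rw [h1.eq_zero (by omega)] at h2
      norm_num at h2
  · rw [ncard_fixedSeq_of_not le_rfl hn (fun h' => h h'.1),
      ncard_last_one 0 (fun c => TailCond n k 1 (numOnes 1 c) ∧ PairEq (1 - 1) c)]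
    rw [ncard_congr_iff (Q := fun c => IsBallot 0 c ∧ k + 1 = n)]
    · exact ncard_isBallot_zero_and (fun _ => k + 1 = n)
    · intro c
      have h1 := numOnes_update_one 0 c
      rw [numOnes_zero, zero_add] at h1
      rw [zero_add, h1]
      have : PairEq (1 - 1) (Function.update c 1 1) := fun i a1 a2 _ => by omega
      have : TailCond n k 1 1 ↔ k + 1 = n := by
        unfold TailCond
        omega
      tauto

theorem ncard_fixedSeq_zero {n k : ℕ} (hn : 1 ≤ n) : (FixedSeq n k 0).ncard =
    if k = n then 1 else 0 := by
  have hall : ∀ q, IsBallot n q → del n q = 0 → ∀ i, 1 ≤ i → i ≤ n → q i = 1 := by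
    intro q h1 h2 i
    induction i with
    | zero => intro h; omega
    | succ i ih =>
      intro _ hi
      rcases Nat.eq_zero_or_pos i with rfl | h0
      · exact h1.first hn
      · rcases h1.pm (i := i + 1) (by omega) hi with h3 | h3
        · exact h3
        · exact absurd ⟨ih h0 (by omega), h3⟩ ((del_spec n q).2 i (by omega) (by omega))
  set o : ℕ → ℤ := fun i => if 1 ≤ i ∧ i ≤ n then 1 else 0 with ho
  have hone : ∀ i, 1 ≤ i → i ≤ n → o i = 1 := fun i h1 h2 => if_pos ⟨h1, h2⟩
  have hpm : ∀ i, 1 ≤ i → i ≤ n → o i = 1 ∨ o i = -1 := fun i h1 h2 => Or.inl (hone i h1 h2)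
  have hht : ∀ j ≤ n, height o j = j := by
    intro j hj
    have := height_add_of_const (c := o) (d := 0) (a := j) (v := 1)
      (fun i h1 h2 => hone i h1 (by omega))
    simpa [height_zero] using this
  have hbal : IsBallot n o := isBallot_of hpm (fun i hi => if_neg hi)
    (fun j hj => by rw [hht j hj]; positivity)
  have hnum : numOnes n o = n := by
    have := hbal.height_eq le_rfl
    rw [hht n le_rfl] at this
    omega
  have hdel : del n o = 0 := by
    rcases (del_spec n o).1 with h | ⟨h1, h2, -, h3⟩
    · exact h
    · rw [hone _ (by omega) (by omega)] at h3; norm_num at h3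
  have heq : ∀ q, IsBallot n q → del n q = 0 → q = o := by
    intro q h1 h2
    funext i
    by_cases hi : 1 ≤ i ∧ i ≤ n
    · rw [hall q h1 h2 i hi.1 hi.2, hone i hi.1 hi.2]
    · rw [h1.eq_zero hi, hbal.eq_zero hi]
  split_ifs with hk
  · rw [show FixedSeq n k 0 = {o} from ?_, Set.ncard_singleton]
    ext q
    constructor
    · rintro ⟨h1, -, h2, -⟩; exact heq q h1 h2
    · rintro rfl
      refine ⟨hbal, hnum.trans hk.symm, hdel, fun h => ?_, fun h => ?_⟩
      · have := h.2
        omega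
      · exact absurd h.2.2 (by decide)
  · refine ncard_eq_zero_of ?_
    rintro q ⟨h1, h2, h3, -⟩
    rw [heq q h1 h3, hnum] at h2
    exact hk h2.symm

/-! ### Summation -/

/-- Binomial coefficients with an arbitrary integer as lower index. -/
def intChoose (n : ℕ) (j : ℤ) : ℤ := if 0 ≤ j then (n.choose j.toNat : ℤ) else 0

theorem intChoose_natCast (n j : ℕ) : intChoose n j = n.choose j := by simp [intChoose]

theorem intChoose_of_neg {n : ℕ} {j : ℤ} (h : j < 0) : intChoose n j = 0 := if_neg (by omega)

theorem intChoose_of_gt {n : ℕ} {j : ℤ} (h : (n : ℤ) < j) : intChoose n j = 0 := by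
  rw [intChoose, if_pos (by omega), Nat.choose_eq_zero_of_lt (by omega)]; rfl

theorem intChoose_succ (n : ℕ) (j : ℤ) :
    intChoose (n + 1) j = intChoose n (j - 1) + intChoose n j := by
  rcases lt_trichotomy j 0 with h | rfl | h
  · rw [intChoose_of_neg h, intChoose_of_neg h, intChoose_of_neg (by omega)]; rfl
  · simp [intChoose]
  · obtain ⟨i, rfl⟩ : ∃ i : ℕ, j = (i + 1 : ℕ) := ⟨(j - 1).toNat, by omega⟩
    rw [show ((i + 1 : ℕ) : ℤ) - 1 = (i : ℕ) by push_cast; ring, intChoose_natCast, intChoose_natCast,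
      intChoose_natCast, Nat.choose_succ_succ]
    push_cast; ring

theorem intChoose_symm {n : ℕ} {i j : ℤ} (h : i + j = n) : intChoose n i = intChoose n j := by
  rcases lt_or_ge i 0 with h1 | h1
  · rw [intChoose_of_neg h1, intChoose_of_gt (by omega)]
  · rcases lt_or_ge j 0 with h2 | h2
    · rw [intChoose_of_neg h2, intChoose_of_gt (by omega)]
    · lift i to ℕ using h1
      lift j to ℕ using h2
      rw [intChoose_natCast, intChoose_natCast, Nat.choose_symm_of_eq_add (show n = i + j by omega)]

/-- A sum of ballot numbers over an interval. -/
theorem sum_ballotNum_window {e lo hi : ℕ} (h1 : e ≤ 2 * lo + 1) (h2 : lo ≤ hi) :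
    (∑ s ∈ Finset.range (e + 1), if lo ≤ s ∧ s < hi then ballotNum e s else 0) =
      intChoose e lo - intChoose e hi := by
  induction hi, h2 using Nat.le_induction with
  | base =>
    rw [sub_self]
    exact Finset.sum_eq_zero fun s _ => if_neg (by omega)
  | succ hi h2 ih =>
    have e1 : ∀ s, (if lo ≤ s ∧ s < hi + 1 then ballotNum e s else 0) =
        (if lo ≤ s ∧ s < hi then ballotNum e s else 0) + if s = hi then ballotNum e hi else 0 := by
      intro s
      rcases eq_or_ne s hi with rfl | h
      · simp [h2]
      · have : (lo ≤ s ∧ s < hi + 1) ↔ (lo ≤ s ∧ s < hi) := by omega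
        rw [if_congr this rfl rfl, if_neg h, add_zero]
    rw [Finset.sum_congr rfl fun s _ => e1 s, Finset.sum_add_distrib, ih, Finset.sum_ite_eq',
      intChoose_natCast, intChoose_natCast, intChoose_natCast]
    split_ifs with h3
    · rw [ballotNum_eq (by omega)]; ring
    · rw [Finset.mem_range, not_lt] at h3
      rw [Nat.choose_eq_zero_of_lt (show e < hi by omega), Nat.choose_eq_zero_of_lt (show e < hi + 1 by omega)]
      simp

theorem pairCount_window {e lo hi : ℕ} {G : ℕ → Prop} (h1 : e ≤ 2 * lo + 1) (h2 : lo ≤ hi)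
    (hG : ∀ s, G (2 * s + 1) ↔ lo ≤ s ∧ s < hi) :
    (pairCount e G : ℤ) = intChoose e lo - intChoose e hi := by
  rw [pairCount_eq_sum, ← sum_ballotNum_window h1 h2]
  refine Finset.sum_congr rfl fun s _ => ?_
  classical exact if_congr (hG s) rfl rfl

/-- Version of `pairCount_window` with two lower bounds that are mirror images of each other. -/
theorem pairCount_window_symm {e hi : ℕ} {a b : ℤ} {G : ℕ → Prop} (hab : a + b = e)
    (ha : a ≤ hi) (hb : b ≤ hi) (hG : ∀ s : ℕ, G (2 * s + 1) ↔ (a ≤ s ∧ b ≤ s) ∧ s < hi) :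
    (pairCount e G : ℤ) = intChoose e a - intChoose e hi := by
  -- Since `a + b = e`, the larger bound is at least `e / 2`, so it is nonnegative and lies in the
  -- range where the ballot numbers telescope.
  rw [pairCount_window (lo := (max a b).toNat) (hi := hi) (by omega) (by omega)]
  · congr 1
    rw [Int.toNat_of_nonneg (by omega)]
    rcases le_total a b with h | h
    · rw [max_eq_right h, intChoose_symm hab]
    · rw [max_eq_left h]
  · intro s
    rw [hG]
    omega

/-- The pair of windows which arises for an odd last descent. -/
theorem pairCount_window_pair {e hi : ℕ} {a b : ℤ} {G G' : ℕ → Prop} (hab : a + b = e - 1)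
    (ha : a + 1 ≤ hi) (hb : b + 1 ≤ hi)
    (hG : ∀ s : ℕ, G (2 * s + 1) ↔ (a ≤ s ∧ b ≤ s) ∧ s < hi)
    (hG' : ∀ s : ℕ, G' (2 * s + 1) ↔ (a + 1 ≤ s ∧ b + 1 ≤ s) ∧ s < hi) :
    (pairCount e G : ℤ) + pairCount e G' = intChoose (e + 1) (a + 1) - 2 * intChoose e hi := by
  rw [pairCount_window (G := G) (lo := (max a b).toNat) (hi := hi) (by omega) (by omega),
    pairCount_window (G := G') (lo := (max a b + 1).toNat) (hi := hi) (by omega) (by omega)]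
  -- The two telescoped sums start at adjacent lower indices and combine by Pascal's rule. The
  -- result is symmetric in `a` and `b`, because `(a + 1) + (b + 1) = e + 1`.
  · have : intChoose (e + 1) (a + 1) = intChoose (e + 1) (max a b + 1) := by
      rcases le_total a b with h | h
      · rw [max_eq_right h]; exact intChoose_symm (by push_cast; omega)
      · rw [max_eq_left h]
    have t1 : ((max a b).toNat : ℤ) = max a b := by omega
    have t2 : ((max a b + 1).toNat : ℤ) = max a b + 1 := by omega
    rw [this, intChoose_succ, t1, t2, add_sub_cancel_right]
    ring
  · intro s
    rw [hG']
    omega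
  · intro s
    rw [hG]
    omega

/-- Since `C(m,r) - C(m,r+1)` changes sign under `r ↦ m - 1 - r`, which carries `t - r` to `t + 1 +
r - m`, the left side is a folded form of its convolution with `C(e, t - r)` over all integers `r`,
and Vandermonde gives the right side. The proof is an induction on `m` by Pascal's rule, which needs
all integers `t`. -/
theorem sum_ballotNum_mul (e m : ℕ) : ∀ t : ℤ,
    ∑ r ∈ Finset.range (m + 1), ballotNum m r * (intChoose e (t - r) - intChoose e (t + 1 + r - m)) =
      intChoose (m + e) t - intChoose (m + e) (t + 1) := by
  induction m with
  | zero => intro t; simp [ballotNum]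
  | succ m ih =>
    intro t
    rw [Finset.sum_range_succ', ballotNum_eq_zero (show 2 * 0 < m + 1 by omega), zero_mul, add_zero]
    have h1 : ∀ r : ℕ, ballotNum (m + 1) (r + 1) * (intChoose e (t - (r + 1 : ℕ)) -
        intChoose e (t + 1 + (r + 1 : ℕ) - (m + 1 : ℕ))) =
        ballotNum m r * (intChoose e (t - 1 - r) - intChoose e (t + 1 + r - m)) +
        ballotNum m (r + 1) * (intChoose e (t - (r + 1 : ℕ)) - intChoose e (t + (r + 1 : ℕ) - m)) := by
      intro r
      rw [ballotNum_succ, show t - (r + 1 : ℕ) = t - 1 - r by push_cast; ring,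
        show t + 1 + (r + 1 : ℕ) - (m + 1 : ℕ) = t + 1 + r - m by push_cast; ring,
        show t + (r + 1 : ℕ) - m = t + 1 + r - m by push_cast; ring]
      split_ifs with h
      · ring
      -- On the boundary `m = 2(r + 1)` the ballot recursion drops a term whose ballot number need
      -- not vanish, but there the two binomial coefficients coincide.
      · rcases eq_or_ne m (2 * (r + 1)) with h2 | h2
        · rw [show t + 1 + r - (m : ℤ) = t - 1 - r by rw [h2]; push_cast; ring]; ring
        · rw [ballotNum_eq_zero (m := m) (r := r + 1) (by omega)]; ring
    rw [Finset.sum_congr rfl fun r _ => h1 r, Finset.sum_add_distrib]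
    -- Reindexing from `r + 1` to `r` is free because both boundary terms vanish.
    have h2 := Finset.sum_range_succ' (fun r : ℕ => ballotNum m r * (intChoose e (t - r) -
      intChoose e (t + r - m))) (m + 1)
    rw [Finset.sum_range_succ, ballotNum_eq_zero' (show m < m + 1 by omega), zero_mul, add_zero] at h2
    have h3 : ballotNum m 0 * (intChoose e (t - (0 : ℕ)) - intChoose e (t + (0 : ℕ) - m)) = 0 := by
      rcases Nat.eq_zero_or_pos m with rfl | h
      · simp
      · rw [ballotNum_eq_zero (by omega), zero_mul]
    rw [h3, add_zero] at h2
    rw [← h2, ← Finset.sum_add_distrib]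
    have h4 := ih t
    have h5 := ih (t - 1)
    have h6 : ∀ r : ℕ, ballotNum m r * (intChoose e (t - 1 - r) - intChoose e (t + 1 + r - m)) +
        ballotNum m r * (intChoose e (t - r) - intChoose e (t + r - m)) =
        ballotNum m r * (intChoose e (t - r) - intChoose e (t + 1 + r - m)) +
        ballotNum m r * (intChoose e (t - 1 - r) - intChoose e (t - 1 + 1 + r - m)) := by
      intro r; rw [sub_add_cancel]; ring
    rw [Finset.sum_congr rfl fun r _ => h6 r, Finset.sum_add_distrib, h4, h5,
      show m + 1 + e = m + e + 1 by ring, intChoose_succ, intChoose_succ (m + e) (t + 1),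
      sub_add_cancel, add_sub_cancel_right]
    ring

/-- Follows from Pascal's rule and the absorption identity `(n+1) C(n,k) = (k+1) C(n+1,k+1)`. -/
theorem ballotNumber_eq (n k : ℕ) :
    ballotNumber n k = ((intChoose n k - intChoose n (k + 1) : ℤ) : ℚ) := by
  have h1 : ((n + 1 : ℕ) : ℚ) * n.choose k = (n + 1).choose (k + 1) * (k + 1 : ℕ) := by
    exact_mod_cast Nat.add_one_mul_choose_eq n k
  have h2 : ((n + 1).choose (k + 1) : ℚ) = n.choose k + n.choose (k + 1) := by
    exact_mod_cast Nat.choose_succ_succ n k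
  have h3 : intChoose n ((k : ℤ) + 1) = n.choose (k + 1) := by
    rw [← intChoose_natCast]; push_cast; rfl
  rw [h3, intChoose_natCast, ballotNumber]
  have h0 : (n : ℚ) + 1 ≠ 0 := by positivity
  push_cast at h1 ⊢
  rw [div_mul_eq_mul_div, div_eq_iff h0]
  rw [h2] at h1 ⊢
  linarith

/-! ### Splitting by the parity of `k`, and the values of `f`. -/

theorem sum_range_two_mul (g : ℕ → ℤ) (m : ℕ) : ∑ k ∈ Finset.range (2 * m), g k =
    ∑ r ∈ Finset.range m, (g (2 * r) + g (2 * r + 1)) := by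
  induction m with
  | zero => simp
  | succ m ih =>
    rw [show 2 * (m + 1) = 2 * m + 1 + 1 by ring, Finset.sum_range_succ, Finset.sum_range_succ, ih,
      Finset.sum_range_succ]
    ring

theorem f_odd_eq_sum (m d : ℕ) : (f (2 * m + 1) d : ℤ) =
    ∑ r ∈ Finset.range (m + 1), ballotNum m r * (FixedSeq (2 * m + 1) (2 * r + 1) d).ncard := by
  rw [f_eq_sum]
  push_cast
  rw [show 2 * m + 1 + 1 = 2 * (m + 1) by ring, sum_range_two_mul]
  refine Finset.sum_congr rfl fun r _ => ?_
  rw [ncard_Astar_odd, pairCount_even, ncard_Astar_odd, pairCount_odd]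
  simp

theorem f_even_eq_sum (m d : ℕ) : (f (2 * m + 2) d : ℤ) =
    ∑ r ∈ Finset.range (m + 1), ballotNum m r * ((FixedSeq (2 * m + 2) (2 * r + 1) d).ncard +
      (FixedSeq (2 * m + 2) (2 * r + 2) d).ncard) := by
  rw [f_eq_sum]
  push_cast
  rw [Finset.sum_range_succ', ncard_Astar_even_zero, show 2 * m + 2 = 2 * (m + 1) by ring,
    sum_range_two_mul]
  simp only [Nat.cast_zero, zero_mul, add_zero]
  refine Finset.sum_congr rfl fun r _ => ?_
  rw [show 2 * (m + 1) = 2 * m + 2 by ring, ncard_Astar_even_odd,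
    show 2 * r + 1 + 1 = 2 * r + 2 by ring, ncard_Astar_even_even]
  ring

theorem sum_ballotNum_single {m : ℕ} (G : ℕ → ℤ) (h1 : G m = 1) (h0 : ∀ r < m, G r = 0) :
    ∑ r ∈ Finset.range (m + 1), ballotNum m r * G r = 1 := by
  rw [Finset.sum_range_succ, Finset.sum_eq_zero, zero_add, h1, mul_one, ballotNum_eq (by omega)]
  · simp
  · intro r hr
    rw [h0 r (Finset.mem_range.1 hr), mul_zero]

theorem sum_ballotNum_congr {m : ℕ} {G G' : ℕ → ℤ} (h : ∀ r, m ≤ 2 * r → G r = G' r) :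
    ∑ r ∈ Finset.range (m + 1), ballotNum m r * G r =
      ∑ r ∈ Finset.range (m + 1), ballotNum m r * G' r := by
  refine Finset.sum_congr rfl fun r _ => ?_
  by_cases hr : m ≤ 2 * r
  · rw [h r hr]
  · rw [ballotNum_eq_zero (by omega), zero_mul, zero_mul]

theorem f_odd_zero (m : ℕ) : (f (2 * m + 1) 0 : ℤ) = 1 := by
  rw [f_odd_eq_sum]
  refine sum_ballotNum_single _ ?_ fun r hr => ?_
  · rw [ncard_fixedSeq_zero (by omega), if_pos rfl]; rfl
  · rw [ncard_fixedSeq_zero (by omega), if_neg (by omega)]; rfl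

theorem f_even_zero (m : ℕ) : (f (2 * m + 2) 0 : ℤ) = 1 := by
  rw [f_even_eq_sum]
  refine sum_ballotNum_single _ ?_ fun r hr => ?_
  · rw [ncard_fixedSeq_zero (by omega), ncard_fixedSeq_zero (by omega), if_neg (by omega), if_pos rfl]
    rfl
  · rw [ncard_fixedSeq_zero (by omega), ncard_fixedSeq_zero (by omega), if_neg (by omega),
      if_neg (by omega)]
    rfl

theorem f_even_one (m : ℕ) : (f (2 * m + 2) 1 : ℤ) = 1 := by
  rw [f_even_eq_sum, Finset.sum_congr rfl (g := fun r => ballotNum m r * if r = m then 1 else 0)]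
  · exact sum_ballotNum_single _ (if_pos rfl) fun r hr => if_neg (by omega)
  · intro r hr
    rw [Finset.mem_range] at hr
    rw [ncard_fixedSeq_one (by omega) (by omega), ncard_fixedSeq_one (by omega) (by omega),
      if_neg (show ¬ 2 * r + 2 + 1 = 2 * m + 2 by omega)]
    by_cases h : r = m
    · rw [if_pos h, if_pos (by omega)]; rfl
    · rw [if_neg h, if_neg (by omega)]; rfl

theorem f_odd_even {m e : ℕ} (h : e + 1 ≤ m) : (f (2 * m + 1) (2 * e + 2) : ℤ) =
    intChoose (m + e) ((m : ℤ) - 1) - intChoose (m + e) m := by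
  have h1 := sum_ballotNum_mul e m ((m : ℤ) - 1)
  rw [sub_add_cancel] at h1
  rw [f_odd_eq_sum, ← h1]
  refine sum_ballotNum_congr fun r hr => ?_
  -- With `2s + 2` ones up to `d`, the bound `a` is nonnegativity of the partial sums, `b` is the
  -- presence of a `-1` after `d`, and `hi` limits the ones to `k`.
  rw [ncard_fixedSeq_even (by omega), pairCount_window_symm (a := (m : ℤ) - 1 - r)
    (b := r - m + e + 1) (hi := r) (by ring) (by omega) (by omega)]
  · rw [show (m : ℤ) + r - m = r by ring]
  · intro s
    unfold TailCond
    omega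

/-- For odd `n` only odd `k` contribute, so `n - k` is even. For `d ≥ 3` an admissible `q` would
have `k - 1` ones in a paired sequence of odd length, contradicting parity; for `d = 1` it would
need `k = n - 1`. -/
theorem f_odd_odd (m e : ℕ) (h : 2 * e + 1 < 2 * m + 1) : f (2 * m + 1) (2 * e + 1) = 0 := by
  have h0 : (f (2 * m + 1) (2 * e + 1) : ℤ) = 0 := by
    rw [f_odd_eq_sum]
    refine Finset.sum_eq_zero fun r hr => ?_
    rw [Finset.mem_range] at hr
    rcases e with _ | e
    · rw [ncard_fixedSeq_one (by omega) (by omega), if_neg (by omega)]; simp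
    · rw [show 2 * (e + 1) + 1 = 2 * e + 3 by ring, ncard_fixedSeq_odd_of_even (by omega)
        ⟨m - r, by omega⟩]
      have : pairCount e (fun s => s + 1 = 2 * r + 1 ∧
          TailCond (2 * m + 1) (2 * r + 1) (2 * e + 3) (s + 1)) = 0 := by
        refine ncard_eq_zero_of ?_
        rintro c ⟨h1, h2, h3, -⟩
        obtain ⟨s, hs⟩ := numOnes_odd h1 h2
        omega
      rw [this]; simp
  exact_mod_cast h0

theorem f_even_even {m e : ℕ} (h : e + 1 ≤ m) : (f (2 * m + 2) (2 * e + 2) : ℤ) =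
    intChoose (m + (e + 1)) m - intChoose (m + (e + 1)) (m + 1) := by
  rw [f_even_eq_sum, ← sum_ballotNum_mul]
  refine sum_ballotNum_congr fun r hr => ?_
  rw [ncard_fixedSeq_even (by omega), ncard_fixedSeq_even (by omega),
    pairCount_window_symm (a := (m : ℤ) - r) (b := r - m + e) (hi := r) (by ring) (by omega) (by omega),
    pairCount_window_symm (a := (m : ℤ) - r - 1) (b := r - m + e + 1) (hi := r + 1) (by ring)
      (by push_cast; omega) (by push_cast; omega)]
  · rw [show (m : ℤ) + 1 + r - m = r + 1 by ring, intChoose_succ, intChoose_succ,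
      add_sub_cancel_right]
    push_cast
    ring
  · intro s
    unfold TailCond
    omega
  · intro s
    unfold TailCond
    omega

/-- For `k = 2r + 1` the two windows give `C(e+1, m-r) - 2 C(e,r)`; for `k = 2r + 2` a single ballot
number `C(e,r) - C(e,r+1)` is added. The sum is `C(e+1, m-r) - C(e+1, r+1)`, as for the even last
descent `2e + 2`. -/
theorem f_even_odd {m e : ℕ} (h : e + 1 ≤ m) : (f (2 * m + 2) (2 * e + 3) : ℤ) =
    intChoose (m + (e + 1)) m - intChoose (m + (e + 1)) (m + 1) := by
  rw [f_even_eq_sum, ← sum_ballotNum_mul]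
  refine Finset.sum_congr rfl fun r hr => ?_
  rw [Finset.mem_range] at hr
  by_cases hmr : m ≤ 2 * r
  swap
  · rw [ballotNum_eq_zero (by omega), zero_mul, zero_mul]
  congr 1
  rw [ncard_fixedSeq_odd_of_odd (by omega) ⟨m - r, by omega⟩,
    ncard_fixedSeq_odd_of_even (by omega) ⟨m - r, by omega⟩]
  push_cast
  rw [pairCount_window_pair (a := (m : ℤ) - r - 1) (b := r - m + e) (hi := r) (by ring) (by omega)
    (by omega), pairCount_congr (G' := (· = 2 * r + 1)), pairCount_odd, ballotNum_eq (by omega)]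
  · rw [show (m : ℤ) + 1 + r - m = r + 1 by ring, sub_add_cancel, intChoose_succ e (r + 1),
      add_sub_cancel_right, ← intChoose_natCast, ← intChoose_natCast]
    push_cast
    ring
  · intro s
    unfold TailCond
    omega
  · intro s
    unfold TailCond
    omega
  · intro s
    unfold TailCond
    omega

end SignBalance

theorem proposition4p3 (n : ℕ) (hn : 2 ≤ n) :
    (∀ π : SignBalance.T n, ∃! σ : SignBalance.T n, SignBalance.IsPsi π σ) ∧
    ∀ d : ℕ, d < n →
      (Odd n → Even d →
        (SignBalance.f n d : ℚ) = SignBalance.ballotNumber ((n + d - 3) / 2) ((n - 3) / 2)) ∧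
      (Odd n → ¬ Even d → SignBalance.f n d = 0) ∧
      (Even n →
        (SignBalance.f n d : ℚ) = SignBalance.ballotNumber ((n + d - 2) / 2) ((n - 2) / 2)) := by

  open SignBalance in
  refine ⟨existsUnique_isPsi, fun d hd => ⟨?_, ?_, ?_⟩⟩
  · rintro ⟨m, rfl⟩ ⟨e, rfl⟩
    obtain ⟨m, rfl⟩ : ∃ j, m = j + 1 := ⟨m - 1, by omega⟩
    rw [ballotNumber_eq]
    rcases e with _ | e
    · rw [show (2 * (m + 1) + 1 + (0 + 0) - 3) / 2 = m by omega,
        show (2 * (m + 1) + 1 - 3) / 2 = m by omega, intChoose_natCast, intChoose_of_gt (by omega)]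
      have := f_odd_zero (m + 1)
      simp
      exact_mod_cast this
    · rw [show (2 * (m + 1) + 1 + (e + 1 + (e + 1)) - 3) / 2 = m + 1 + e by omega,
        show (2 * (m + 1) + 1 - 3) / 2 = m by omega, show e + 1 + (e + 1) = 2 * e + 2 by ring]
      have := f_odd_even (m := m + 1) (e := e) (by omega)
      push_cast at this
      rw [add_sub_cancel_right] at this
      rw [← this]; norm_cast
  · rintro ⟨m, rfl⟩ ho
    obtain ⟨e, rfl⟩ := Nat.not_even_iff_odd.1 ho
    exact f_odd_odd m e hd
  · rintro ⟨m, rfl⟩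
    obtain ⟨m, rfl⟩ : ∃ j, m = j + 1 := ⟨m - 1, by omega⟩
    rw [ballotNumber_eq, show m + 1 + (m + 1) = 2 * m + 2 by ring] at *
    rw [show (2 * m + 2 - 2) / 2 = m by omega]
    rcases Nat.lt_or_ge d 2 with h2 | h2
    -- For `d = 0` and `d = 1` the ballot number is `C(m,m) - C(m,m+1) = 1`.
    · rw [show (2 * m + 2 + d - 2) / 2 = m by omega, intChoose_natCast, intChoose_of_gt (by omega)]
      have : (f (2 * m + 2) d : ℤ) = 1 := by
        interval_cases d
        · exact f_even_zero m
        · exact f_even_one m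
      simp
      exact_mod_cast this
    · obtain ⟨e, he⟩ : ∃ e, d = 2 * e + 2 ∨ d = 2 * e + 3 := ⟨d / 2 - 1, by omega⟩
      rw [show (2 * m + 2 + d - 2) / 2 = m + (e + 1) by omega]
      have : (f (2 * m + 2) d : ℤ) =
          intChoose (m + (e + 1)) m - intChoose (m + (e + 1)) (m + 1) := by
        rcases he with rfl | rfl
        · exact f_even_even (by omega)
        · exact f_even_odd (by omega)
      rw [← this]; norm_cast
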